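/- Let $G=\mathrm{SU}(2)\cong\mathbb S^3$ with normalised Haar measure, and let $\mathcal D'(G)$ be the space of distributions, i.e. of continuous linear functionals on $C^\infty(G)$, with $C^\infty(G)\subset\mathcal D'(G)$ through $\langle f,\varphi\rangle=\int_G f\varphi\,dx$. For $X\in\mathfrak{su}(2)$ let $(\partial_Xf)(x)=\frac{d}{dt}\big|_{t=0}f(x\exp(tX))$ be the derivative along the corresponding left-invariant vector field, extended to $\mathcal D'(G)$ by $\langle\partial_Xu,\varphi\rangle=-\langle u,\partial_X\varphi\rangle$. A differential operator $A$ is called globally hypoelliptic if $u\in\mathcal D'(G)$ and $Au\in C^\infty(G)$ imply $u\in C^\infty(G)$. (1) Let $X\in\mathfrak{su}(2)$ be normalised by $\det X=\frac14$, i.e. $X$ has eigenvalues $\pm\frac{\mathrm i}{2}$ (equivalently, $X$ is conjugate to $Y_3=\mathrm{diag}(\frac{\mathrm i}2,-\frac{\mathrm i}2)$; put $\mathrm D_3=\partial_{Y_3}$), and let $c\in\mathbb C$. Then - $\partial_X+c$ is globally hypoelliptic if and only if $\mathrm ic\notin\frac12\mathbb Z$; - for every integer $k\ge 0$, $\partial_X^k+c$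 is globally hypoelliptic if and only if $c\notin-(-\mathrm i)^k(\frac12\mathbb Z)^k$, where $(\frac12\mathbb Z)^k=\{2^{-k}l^k:l\in\mathbb Z\}$ (with $0^0=1$); - in particular, $\partial_X^2+c$ is globally hypoelliptic if and only if $4c\notin\{l^2:l\in\mathbb Z\}$. (2) For every $X\in\mathfrak{su}(2)$ and every complex-valued $a\in C^\infty(G)$, the operator $\partial_X^2+a(x)\partial_X$ is not globally hypoelliptic. (3) For $\partial_X=\mathrm D_3$ this is shown by one explicit distribution. For $\ell\in\frac12\mathbb N_0$ let $t^\ell=(t^\ell_{mn})_{m,n=-\ell,\dots,\ell}$ be the irreducible unitary representation of $G$ of dimension $2\ell+1$, realised as $(T(x)p)(z)=p(zx)$ on the homogeneous polynomials of degree $2\ell$ in $z=(z_1,z_2)$ in the basis $q_m(z)=z_1^{\ell-m}z_2^{\ell+m}/\sqrt{(\ell-m)!(\ell+m)!}$, so that $T(x)q_n=\sum_m t^\ell_{mn}(x)q_m$. Then the series $$f=\sum_{\ell\in\mathbb N_0}(2\ell+1)\,t^\ell_{00}$$ converges in $\mathcal D'(G)$ (that is, $\sum_{\ell}(2\ell+1)\int_G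 t^\ell_{00}\varphi\,dx$ converges to $\langle f,\varphi\rangle$ for every $\varphi\in C^\infty(G)$), the distribution $f$ is not smooth, and $(\mathrm D_3^2+a(x)\mathrm D_3)f=0$ for every $a\in C^\infty(G)$. -/

import Mathlib

open scoped ContDiff

noncomputable section

namespace GlobalHypo

/-! ### The group `SU(2)` and its Lie algebra -/

abbrev Mat2 : Type := Matrix (Fin 2) (Fin 2) ℂ

/-- The compact Lie group `SU(2)`, a closed subgroup of the `2 × 2` complex matrices. -/
abbrev SU2 : Type := ↥(Matrix.specialUnitaryGroup (Fin 2) ℂ)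

instance : IsTopologicalGroup SU2 where
  continuous_mul := continuous_mul
  continuous_inv := by
    refine Continuous.subtype_mk (f := fun x : SU2 => star (x : Mat2)) ?_ _
    exact continuous_subtype_val.star

instance : CompactSpace SU2 := by
  apply isCompact_iff_compactSpace.1
  have hsub : ((Matrix.specialUnitaryGroup (Fin 2) ℂ : Submonoid Mat2) : Set Mat2) ⊆
      Set.pi Set.univ (fun _ : Fin 2 => Set.pi Set.univ
        (fun _ : Fin 2 => Metric.closedBall (0 : ℂ) 1)) := by
    intro x hx i _ j _
    simpa using entry_norm_bound_of_unitary
      (Matrix.specialUnitaryGroup_le_unitaryGroup hx) i j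
  have hcl : IsClosed ((Matrix.specialUnitaryGroup (Fin 2) ℂ : Submonoid Mat2) : Set Mat2) := by
    have : ((Matrix.specialUnitaryGroup (Fin 2) ℂ : Submonoid Mat2) : Set Mat2) =
        {x : Mat2 | x * star x = 1} ∩ {x : Mat2 | x.det = 1} := by
      ext x
      simp [Matrix.mem_specialUnitaryGroup_iff, Matrix.mem_unitaryGroup_iff]
    rw [this]
    refine IsClosed.inter ?_ ?_
    · exact isClosed_eq (continuous_id.mul continuous_id.star) continuous_const
    · exact isClosed_eq (Continuous.matrix_det continuous_id) continuous_const
  refine IsCompact.of_isClosed_subset ?_ hcl hsub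
  exact isCompact_univ_pi fun _ => isCompact_univ_pi fun _ => isCompact_closedBall 0 1

instance : MeasurableSpace SU2 := borel SU2

instance : BorelSpace SU2 := ⟨rfl⟩

/-- The Haar measure of `SU(2)`, normalised to total mass one. -/
def haar : MeasureTheory.Measure SU2 := MeasureTheory.Measure.haarMeasure ⊤

/-- The Lie algebra `su(2)`: the traceless skew-Hermitian matrices. -/
def su2 : Submodule ℝ Mat2 where
  carrier := {X | star X = -X ∧ X.trace = 0}
  add_mem' := by
    rintro X Y ⟨hX, hX'⟩ ⟨hY, hY'⟩
    exact ⟨by rw [star_add, hX, hY]; abel, by rw [Matrix.trace_add, hX', hY', add_zero]⟩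
  zero_mem' := ⟨by simp, by simp⟩
  smul_mem' := by
    rintro c X ⟨hX, hX'⟩
    exact ⟨by rw [star_smul, hX]; simp, by rw [Matrix.trace_smul, hX', smul_zero]⟩

theorem exp_mem {X : Mat2} (hX : X ∈ su2) :
    NormedSpace.exp X ∈ Matrix.specialUnitaryGroup (Fin 2) ℂ := by
  obtain ⟨hs, ht⟩ := hX
  rw [Matrix.mem_specialUnitaryGroup_iff]
  constructor
  · rw [Matrix.mem_unitaryGroup_iff, Matrix.star_eq_conjTranspose, ← Matrix.exp_conjTranspose,
      ← Matrix.star_eq_conjTranspose, hs, ← Matrix.exp_add_of_commute _ _ (Commute.neg_right (Commute.refl X)),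
      add_neg_cancel, NormedSpace.exp_zero]
  have hH : (Complex.I • X).IsHermitian := by
    change star (Complex.I • X) = _
    rw [star_smul, hs]; simp
  obtain ⟨U, hUm, hU⟩ : ∃ U : Mat2, U ∈ unitary Mat2 ∧
      Complex.I • X = U * Matrix.diagonal (fun i => (hH.eigenvalues i : ℂ)) * star U :=
    ⟨_, hH.eigenvectorUnitary.2, hH.spectral_theorem⟩
  have hUu : star U * U = 1 := (Unitary.mem_iff.1 hUm).1
  have hUu' : U * star U = 1 := (Unitary.mem_iff.1 hUm).2
  have hinv : U⁻¹ = star U := Matrix.inv_eq_left_inv hUu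
  have hunit : IsUnit U := IsUnit.of_mul_eq_one _ hUu'
  set v : Fin 2 → ℂ := fun i => -Complex.I * (hH.eigenvalues i : ℂ) with hv
  have hXeq : X = U * Matrix.diagonal v * U⁻¹ := by
    have h2 : X = (-Complex.I) • (Complex.I • X) := by
      rw [smul_smul]; simp
    have h3 : Matrix.diagonal v =
        (-Complex.I) • Matrix.diagonal (fun i => (hH.eigenvalues i : ℂ)) := by
      rw [← Matrix.diagonal_smul]; rfl
    rw [h2, hU, h3, hinv, Matrix.mul_smul, Matrix.smul_mul]
  have hdet : U.det * U⁻¹.det = 1 := by rw [← Matrix.det_mul, hinv, hUu', Matrix.det_one]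
  have htr : v 0 + v 1 = 0 := by
    have h4 : (U * Matrix.diagonal v * U⁻¹).trace = 0 := by rw [← hXeq]; exact ht
    rw [Matrix.trace_mul_comm, ← Matrix.mul_assoc, hinv, hUu, Matrix.one_mul,
      Matrix.trace_diagonal, Fin.sum_univ_two] at h4
    exact h4
  rw [hXeq, Matrix.exp_conj _ _ hunit, Matrix.exp_diagonal, Matrix.det_mul, Matrix.det_mul,
    Matrix.det_diagonal, Fin.prod_univ_two, Pi.coe_exp, Pi.coe_exp, ← Complex.exp_eq_exp_ℂ,
    ← Complex.exp_add, htr, Complex.exp_zero, mul_one, hdet]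

/-- The exponential map `su(2) → SU(2)`. -/
def expSU (X : su2) : SU2 := ⟨NormedSpace.exp (X : Mat2), exp_mem X.2⟩

/-! ### Smooth functions and left-invariant vector fields -/

/-- The matrix entries of `x`, as a point of the real vector space `ℂ⁴ ≅ ℝ⁸`. -/
def entries (x : SU2) : Fin 2 → Fin 2 → ℂ := fun i j => (x : Mat2) i j

/-- `C^∞(SU(2))`: since `SU(2)` is a closed submanifold of the space of all `2 × 2` matrices, the
smooth functions on it are the restrictions of the smooth functions of the (eight real) matrix
entries. -/
def Smooth : Subalgebra ℂ (SU2 → ℂ) where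
  carrier := {f | ∃ F : (Fin 2 → Fin 2 → ℂ) → ℂ, ContDiff ℝ ∞ F ∧ ∀ x, f x = F (entries x)}
  mul_mem' := by
    rintro f g ⟨F, hF, hf⟩ ⟨G, hG, hg⟩
    exact ⟨fun y => F y * G y, hF.mul hG, fun x => by simp [hf, hg]⟩
  add_mem' := by
    rintro f g ⟨F, hF, hf⟩ ⟨G, hG, hg⟩
    exact ⟨fun y => F y + G y, hF.add hG, fun x => by simp [hf, hg]⟩
  algebraMap_mem' := fun c => ⟨fun _ => c, contDiff_const, fun _ => rfl⟩

theorem continuous_entries : Continuous entries :=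
  continuous_subtype_val

theorem smooth_continuous (f : Smooth) : Continuous (f : SU2 → ℂ) := by
  obtain ⟨F, hF, hf⟩ := f.2
  have : (f : SU2 → ℂ) = F ∘ entries := funext hf
  rw [this]
  exact hF.continuous.comp continuous_entries

theorem smooth_bounded (f : Smooth) : ∃ C : ℝ, 0 ≤ C ∧ ∀ x, ‖(f : SU2 → ℂ) x‖ ≤ C := by
  obtain ⟨C, hC⟩ := isCompact_univ.exists_bound_of_continuousOn (smooth_continuous f).continuousOn
  exact ⟨C, (norm_nonneg _).trans (hC 1 trivial), fun x => hC x trivial⟩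

/-- The derivative `(∂_X f)(x) = d/dt f(x exp(tX))` at `t = 0` along the left-invariant vector
field with value `X` at the identity. -/
def derivAlong (X : su2) (f : SU2 → ℂ) (x : SU2) : ℂ :=
  deriv (fun t : ℝ => f (x * expSU (t • X))) 0

open scoped Matrix.Norms.Operator in
theorem hasDerivAt_exp_entry (X : Mat2) (i j : Fin 2) :
    HasDerivAt (fun t : ℝ => (NormedSpace.exp (t • X)) i j) (X i j) 0 := by
  have h : HasDerivAt (fun t : ℝ => (NormedSpace.exp (t • X))) X 0 := by
    have h := hasDerivAt_exp_smul_const (𝕂 := ℝ) X (0 : ℝ)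
    rw [zero_smul, NormedSpace.exp_zero, one_mul] at h
    exact h
  let L : Mat2 →L[ℝ] ℂ := LinearMap.toContinuousLinearMap
    { toFun := fun M => M i j, map_add' := fun _ _ => rfl, map_smul' := fun _ _ => rfl }
  exact L.hasFDerivAt.comp_hasDerivAt (0 : ℝ) h

theorem hasDerivAt_entries (X : su2) (x : SU2) :
    HasDerivAt (fun t : ℝ => entries (x * expSU (t • X)))
      (fun i j => ((x : Mat2) * (X : Mat2)) i j) 0 := by
  refine hasDerivAt_pi.2 fun i => hasDerivAt_pi.2 fun j => ?_
  have h : ∀ t : ℝ, entries (x * expSU (t • X)) i j =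
      ∑ k, (x : Mat2) i k * (NormedSpace.exp (t • (X : Mat2))) k j := fun t => rfl
  simp only [h, Matrix.mul_apply]
  exact HasDerivAt.fun_sum fun k _ => (hasDerivAt_exp_entry (X : Mat2) k j).const_mul _

theorem hasDerivAt_of_extension {f : SU2 → ℂ} {F : (Fin 2 → Fin 2 → ℂ) → ℂ}
    (hF : ContDiff ℝ ∞ F) (hf : ∀ x, f x = F (entries x)) (X : su2) (x : SU2) :
    HasDerivAt (fun t : ℝ => f (x * expSU (t • X)))
      (fderiv ℝ F (entries x) (fun i j => ((x : Mat2) * (X : Mat2)) i j)) 0 := by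
  have h0 : entries (x * expSU ((0 : ℝ) • X)) = entries x := by
    have : expSU ((0 : ℝ) • X) = 1 := by
      apply Subtype.ext
      change NormedSpace.exp ((0 : ℝ) • (X : Mat2)) = 1
      rw [zero_smul, NormedSpace.exp_zero]
    rw [this, mul_one]
  simp only [hf]
  have hFd : HasFDerivAt F (fderiv ℝ F (entries x)) (entries (x * expSU ((0 : ℝ) • X))) := by
    rw [h0]
    exact (hF.differentiable (by simp) _).hasFDerivAt
  exact hFd.comp_hasDerivAt (0 : ℝ) (hasDerivAt_entries X x)

theorem smooth_hasDerivAt (f : Smooth) (X : su2) (x : SU2) :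
    HasDerivAt (fun t : ℝ => (f : SU2 → ℂ) (x * expSU (t • X)))
      (derivAlong X (f : SU2 → ℂ) x) 0 := by
  obtain ⟨F, hF, hf⟩ := f.2
  exact (hasDerivAt_of_extension hF hf X x).differentiableAt.hasDerivAt

theorem derivAlong_mem (X : su2) {f : SU2 → ℂ} (h : f ∈ Smooth) : derivAlong X f ∈ Smooth := by
  obtain ⟨F, hF, hf⟩ := h
  refine ⟨fun y => fderiv ℝ F y (fun i j => ∑ k, y i k * (X : Mat2) k j), ?_, fun x => ?_⟩
  · refine (hF.fderiv_right (m := ∞) (by simp)).clm_apply ?_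
    refine contDiff_pi.2 fun i => contDiff_pi.2 fun j => ContDiff.sum fun k _ => ?_
    exact (contDiff_apply_apply ℝ ℂ i k).mul contDiff_const
  · exact (hasDerivAt_of_extension hF hf X x).deriv

/-- `∂_X` as a linear operator on `C^∞(SU(2))`. -/
def lieDeriv (X : su2) : Smooth →ₗ[ℂ] Smooth where
  toFun f := ⟨derivAlong X f, derivAlong_mem X f.2⟩
  map_add' f g := by
    apply Subtype.ext; funext x
    exact ((smooth_hasDerivAt f X x).add (smooth_hasDerivAt g X x)).deriv
  map_smul' c f := by
    apply Subtype.ext; funext x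
    exact ((smooth_hasDerivAt f X x).const_mul c).deriv

theorem lieDeriv_mul (X : su2) (f g : Smooth) :
    lieDeriv X (f * g) = lieDeriv X f * g + f * lieDeriv X g := by
  apply Subtype.ext; funext x
  have h := ((smooth_hasDerivAt f X x).mul (smooth_hasDerivAt g X x)).deriv
  have h0 : expSU ((0 : ℝ) • X) = 1 := by
    apply Subtype.ext
    change NormedSpace.exp ((0 : ℝ) • (X : Mat2)) = 1
    rw [zero_smul, NormedSpace.exp_zero]
  rw [h0, mul_one] at h
  exact h

/-- The iterated derivative `∂_{X_r} ⋯ ∂_{X_1} f` along the word `[X_1, …, X_r]`. -/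
def iterDeriv : List su2 → Smooth → Smooth
  | [], f => f
  | X :: w, f => iterDeriv w (lieDeriv X f)

theorem iterDeriv_add (w : List su2) (f g : Smooth) :
    iterDeriv w (f + g) = iterDeriv w f + iterDeriv w g := by
  induction w generalizing f g with
  | nil => rfl
  | cons X w ih => simp only [iterDeriv, map_add, ih]

/-! ### Distributions -/

/-- Continuity of a linear functional on `C^∞(SU(2))` for the topology given by the seminorms
`f ↦ sup |∂_{X_r} ⋯ ∂_{X_1} f|`: the functional is bounded by a constant times the
maximum of finitely many of them. -/
def IsContinuousFunctional (u : Smooth →ₗ[ℂ] ℂ) : Prop :=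
  ∃ (S : Finset (List su2)) (C : ℝ), ∀ (φ : Smooth) (M : ℝ),
    (∀ w ∈ S, ∀ x : SU2, ‖(iterDeriv w φ : SU2 → ℂ) x‖ ≤ M) → ‖u φ‖ ≤ C * M

/-- The space `D'(SU(2))` of distributions: the continuous linear functionals on
`C^∞(SU(2))`. -/
def Distribution : Submodule ℂ (Smooth →ₗ[ℂ] ℂ) where
  carrier := {u | IsContinuousFunctional u}
  zero_mem' := ⟨∅, 0, fun φ M _ => by simp⟩
  add_mem' := by
    classical
    rintro u v ⟨S, C, hu⟩ ⟨T, D, hv⟩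
    refine ⟨S ∪ T, C + D, fun φ M h => ?_⟩
    have h1 := hu φ M fun w hw => h w (Finset.mem_union_left _ hw)
    have h2 := hv φ M fun w hw => h w (Finset.mem_union_right _ hw)
    calc ‖u φ + v φ‖ ≤ ‖u φ‖ + ‖v φ‖ := norm_add_le _ _
      _ ≤ (C + D) * M := by linarith
  smul_mem' := by
    rintro c u ⟨S, C, hu⟩
    refine ⟨S, ‖c‖ * C, fun φ M h => ?_⟩
    calc ‖c * u φ‖ = ‖c‖ * ‖u φ‖ := norm_mul _ _
      _ ≤ ‖c‖ * (C * M) := mul_le_mul_of_nonneg_left (hu φ M h) (norm_nonneg _)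
      _ = ‖c‖ * C * M := by ring

theorem comp_lieDeriv_mem (X : su2) {u : Smooth →ₗ[ℂ] ℂ} (hu : u ∈ Distribution) :
    u ∘ₗ lieDeriv X ∈ Distribution := by
  classical
  obtain ⟨S, C, hu⟩ := hu
  refine ⟨S.image (fun w => X :: w), C, fun φ M h => hu _ M fun w hw => ?_⟩
  exact h (X :: w) (Finset.mem_image_of_mem _ hw)

theorem iterDeriv_mul_bound (w : List su2) (a : Smooth) :
    ∃ (S : Finset (List su2)) (C : ℝ), S.Nonempty ∧ 0 ≤ C ∧ ∀ (φ : Smooth) (M : ℝ),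
      (∀ v ∈ S, ∀ x : SU2, ‖(iterDeriv v φ : SU2 → ℂ) x‖ ≤ M) →
        ∀ x : SU2, ‖(iterDeriv w (a * φ) : SU2 → ℂ) x‖ ≤ C * M := by
  classical
  induction w generalizing a with
  | nil =>
    obtain ⟨C, hC, ha⟩ := smooth_bounded a
    refine ⟨{[]}, C, by simp, hC, fun φ M h x => ?_⟩
    have h1 := h [] (by simp) x
    calc ‖(a : SU2 → ℂ) x * (φ : SU2 → ℂ) x‖
        = ‖(a : SU2 → ℂ) x‖ * ‖(φ : SU2 → ℂ) x‖ := norm_mul _ _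
      _ ≤ C * M := mul_le_mul (ha x) h1 (norm_nonneg _) hC
  | cons X w ih =>
    obtain ⟨S, C, hS, hC, h1⟩ := ih (lieDeriv X a)
    obtain ⟨T, D, hT, hD, h2⟩ := ih a
    refine ⟨S ∪ T.image (fun v => X :: v), C + D, hS.mono Finset.subset_union_left,
      add_nonneg hC hD, fun φ M h x => ?_⟩
    have e : iterDeriv (X :: w) (a * φ) =
        iterDeriv w (lieDeriv X a * φ) + iterDeriv w (a * lieDeriv X φ) := by
      rw [iterDeriv, lieDeriv_mul, iterDeriv_add]
    have b1 := h1 φ M (fun v hv => h v (Finset.mem_union_left _ hv)) x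
    have b2 := h2 (lieDeriv X φ) M (fun v hv =>
      h (X :: v) (Finset.mem_union_right _ (Finset.mem_image_of_mem _ hv))) x
    rw [e]
    refine (norm_add_le _ _).trans ?_
    linarith

theorem comp_mul_mem (a : Smooth) {u : Smooth →ₗ[ℂ] ℂ} (hu : u ∈ Distribution) :
    u ∘ₗ LinearMap.mulLeft ℂ a ∈ Distribution := by
  classical
  obtain ⟨S, C, hu⟩ := hu
  choose T D hT hD h using fun w => iterDeriv_mul_bound w a
  refine ⟨insert [] (S.biUnion T), C * ∑ w ∈ S, D w, fun φ M hφ => ?_⟩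
  have hM : 0 ≤ M := (norm_nonneg _).trans (hφ [] (Finset.mem_insert_self _ _) 1)
  rw [mul_assoc]
  refine hu (a * φ) _ fun w hw x => ?_
  refine (h w φ M (fun v hv => hφ v (Finset.mem_insert_of_mem
    (Finset.mem_biUnion.2 ⟨w, hw, hv⟩))) x).trans ?_
  exact mul_le_mul_of_nonneg_right
    (Finset.single_le_sum (fun v _ => hD v) hw) hM

/-- `∂_X` on distributions: `⟨∂_X u, φ⟩ = -⟨u, ∂_X φ⟩`. -/
def distDeriv (X : su2) : Distribution →ₗ[ℂ] Distribution where
  toFun u := ⟨-((u : Smooth →ₗ[ℂ] ℂ) ∘ₗ lieDeriv X),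
    Distribution.neg_mem (comp_lieDeriv_mem X u.2)⟩
  map_add' u v := by
    apply Subtype.ext; ext φ
    simp [add_comm]
  map_smul' c u := by
    apply Subtype.ext; ext φ
    simp

/-- Multiplication of a distribution by a smooth function: `⟨a u, φ⟩ = ⟨u, a φ⟩`. -/
def distMul (a : Smooth) : Distribution →ₗ[ℂ] Distribution where
  toFun u := ⟨(u : Smooth →ₗ[ℂ] ℂ) ∘ₗ LinearMap.mulLeft ℂ a, comp_mul_mem a u.2⟩
  map_add' u v := by
    apply Subtype.ext; ext φ
    simp
  map_smul' c u := by
    apply Subtype.ext; ext φ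
    simp

instance : MeasureTheory.IsProbabilityMeasure haar :=
  ⟨MeasureTheory.Measure.haarMeasure_self⟩

theorem integrable_mul (f φ : Smooth) :
    MeasureTheory.Integrable (fun x => (f : SU2 → ℂ) x * (φ : SU2 → ℂ) x) haar :=
  ((smooth_continuous f).mul (smooth_continuous φ)).integrable_of_hasCompactSupport
    (HasCompactSupport.of_compactSpace _)

/-- The functional `φ ↦ ∫ f φ` (normalised Haar measure) given by a smooth function `f`. -/
def integralFunctional (f : Smooth) : Smooth →ₗ[ℂ] ℂ where
  toFun φ := ∫ x, (f : SU2 → ℂ) x * (φ : SU2 → ℂ) x ∂haar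
  map_add' φ ψ := by
    rw [← MeasureTheory.integral_add (integrable_mul f φ) (integrable_mul f ψ)]
    exact MeasureTheory.integral_congr_ae (Filter.Eventually.of_forall fun x => mul_add _ _ _)
  map_smul' c φ := by
    rw [RingHom.id_apply, smul_eq_mul, ← MeasureTheory.integral_const_mul]
    exact MeasureTheory.integral_congr_ae
      (Filter.Eventually.of_forall fun x => mul_left_comm _ _ _)

/-- The embedding `C^∞(SU(2)) → D'(SU(2))`. -/
def toDistribution (f : Smooth) : Distribution :=
  ⟨integralFunctional f, by
    obtain ⟨C, hC, hf⟩ := smooth_bounded f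
    refine ⟨{[]}, C, fun φ M h => ?_⟩
    have h1 : ∀ x, ‖(f : SU2 → ℂ) x * (φ : SU2 → ℂ) x‖ ≤ C * M := fun x => by
      rw [norm_mul]
      exact mul_le_mul (hf x) (h [] (by simp) x) (norm_nonneg _) hC
    have h2 := MeasureTheory.norm_integral_le_of_norm_le_const (μ := haar)
      (Filter.Eventually.of_forall h1)
    change ‖∫ x, (f : SU2 → ℂ) x * (φ : SU2 → ℂ) x ∂haar‖ ≤ C * M
    simpa using h2⟩

/-- A distribution is smooth if it is given by a function in `C^∞(SU(2))`. -/
def IsSmooth (u : Distribution) : Prop :=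
  ∃ f : Smooth, u = toDistribution f

/-- An operator `A` on distributions is globally hypoelliptic if `A u ∈ C^∞` implies
`u ∈ C^∞`, for every distribution `u`. -/
def GloballyHypoelliptic (A : Distribution →ₗ[ℂ] Distribution) : Prop :=
  ∀ u : Distribution, IsSmooth (A u) → IsSmooth u

/-! ### The field `D₃` and the irreducible representations -/

/-- The element `diag(i/2, -i/2)` of `su(2)`; the corresponding left-invariant field is `D₃`. -/
def Y3 : su2 :=
  ⟨!![Complex.I / 2, 0; 0, -(Complex.I / 2)], by
    constructor
    · ext i j
      fin_cases i <;> fin_cases j <;> simp [Matrix.star_apply, neg_div]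
    · simp [Matrix.trace, Fin.sum_univ_two]⟩

/-- The irreducible representation `t^ℓ` of `SU(2)`, `ℓ = N / 2`, as an `(N+1) × (N+1)` matrix.
Row `i` and column `j` carry the labels `m = i - ℓ` and `n = j - ℓ`. It is the representation
`(T(x) f)(z) = f(z x)` on homogeneous polynomials of degree `2ℓ` in `z = (z₁, z₂)`, in the
orthonormal basis `q_m(z) = z₁^(ℓ-m) z₂^(ℓ+m) / √((ℓ-m)! (ℓ+m)!)`, so that
`T(x) q_n = ∑_m t^ℓ_{mn}(x) q_m`; polynomials are dehomogenised by `z₁ = 1`, `z₂ = X`. -/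
def tMatrix (N : ℕ) (x : SU2) : Matrix (Fin (N + 1)) (Fin (N + 1)) ℂ := fun i j =>
  ((√((N - (i : ℕ)).factorial * (i : ℕ).factorial) /
    √((N - (j : ℕ)).factorial * (j : ℕ).factorial) : ℝ) : ℂ) *
  ((Polynomial.C ((x : Mat2) 0 0) + Polynomial.C ((x : Mat2) 1 0) * Polynomial.X) ^ (N - (j : ℕ)) *
    (Polynomial.C ((x : Mat2) 0 1) + Polynomial.C ((x : Mat2) 1 1) * Polynomial.X) ^ (j : ℕ)).coeff i

/-- The matrix coefficient `t^ℓ_{00}` for an integer `ℓ ≥ 0`. -/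
def tZero (l : ℕ) (x : SU2) : ℂ :=
  tMatrix (2 * l) x ⟨l, by omega⟩ ⟨l, by omega⟩

end GlobalHypo

end

/-! For normalised `X` every orbit of the flow of `∂_X` is a circle of period `4π`, and everything
in (1) and (2) happens on these circles.

A polynomial `p(∂_X)` is globally hypoelliptic exactly when `p` has no zero in `(i/2)ℤ`
(`globallyHypoelliptic_aeval_iff`); the three equivalences of (1) are special cases. If `il/2` is a
zero, then `φ ↦ ∫₀^{4π} e^{ilt/2} φ(exp(tX)) dt` is an eigendistribution of `∂_X` for that
eigenvalue, so `p(∂_X)` kills it. It is not smooth, because it is nonzero and carried by a single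
circle (`not_isSmooth_circleDistribution`). Conversely, if `r ∉ (i/2)ℤ`, the equation `(∂_X - r) g =
f` is solved along each circle by an explicit integral, smooth in the base point
(`exists_lieDerivAdd_eq`). The same holds for `∂_X + r`, which is minus the transpose, so `g` is the
only distributional solution. Factoring `p` into linear factors finishes (1). For (2), the circle
distribution with `l = 0` is annihilated by `∂_X`, hence by every operator `B ∘ ∂_X`.

For (3), `t^n₀₀` is the shifted Legendre polynomial in `w = |x₀₁|²` (`zonal_apply`). Since `w` is
invariant under `D₃`, so is each term of the series. Legendre's equation makes `t^n₀₀` an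
eigenfunction of `Y₁² + Y₂²` with eigenvalue `-n(n+1)`; this yields orthogonality and rapid decay of
the coefficients of a smooth function, hence convergence. The three-term recurrence gives the
squared norm `1/(2n+1)`, so the series pairs to `1` with every `t^n₀₀`, which the decay forbids for
a smooth function. -/

noncomputable section

/-! ### Integrals depending on a parameter -/

/-- Smooth dependence of an interval integral on a finite-dimensional parameter. -/
theorem contDiff_intervalIntegral_of_contDiff_uncurry {E : Type} [NormedAddCommGroup E]
    [NormedSpace ℝ E] [FiniteDimensional ℝ E] (a b : ℝ) (n : ℕ) :
    ∀ {F : Type} [NormedAddCommGroup F] [NormedSpace ℝ F] {H : E → ℝ → F},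
      ContDiff ℝ ∞ (Function.uncurry H) → ContDiff ℝ n fun y => ∫ t in a..b, H y t := by
  -- `F` is quantified after `n`: the induction hypothesis is applied to the partial derivative,
  -- which takes values in `E →L[ℝ] F`.
  induction n with
  | zero =>
    intro F _ _ H hH
    exact contDiff_zero.2
      (intervalIntegral.continuous_parametric_intervalIntegral_of_continuous' hH.continuous a b)
  | succ n ih =>
    intro F _ _ H hH
    let H' : E → ℝ → E →L[ℝ] F := fun y t =>
      (fderiv ℝ (Function.uncurry H) (y, t)).comp (ContinuousLinearMap.inl ℝ E ℝ)
    have hH' : ContDiff ℝ ∞ (Function.uncurry H') := by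
      have h1 : ContDiff ℝ ∞ (fderiv ℝ (Function.uncurry H)) := hH.fderiv_right (by simp)
      exact h1.clm_comp contDiff_const
    have hd : ∀ y t, HasFDerivAt (fun y => H y t) (H' y t) y := by
      intro y t
      have h1 : HasFDerivAt (Function.uncurry H) (fderiv ℝ (Function.uncurry H) (y, t)) (y, t) :=
        (hH.differentiable (by simp) _).hasFDerivAt
      exact h1.comp (f := fun y => (y, t)) y (hasFDerivAt_prodMk_left y t)
    rw [Nat.cast_succ, contDiff_succ_iff_hasFDerivAt]
    refine ⟨fun y => ∫ t in a..b, H' y t, ih hH', fun y => ?_⟩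
    -- Closed balls of `E` are compact by finite dimension, so the continuous `H'` has a constant
    -- bound near `y`; this is the dominating function.
    have hK : IsCompact (Metric.closedBall y 1 ×ˢ Set.uIcc a b) :=
      (isCompact_closedBall y 1).prod isCompact_uIcc
    obtain ⟨C, hC⟩ := hK.exists_bound_of_continuousOn hH'.continuous.continuousOn
    have hcont : ∀ y, Continuous (H y) := fun y =>
      hH.continuous.comp (Continuous.prodMk continuous_const continuous_id)
    have hcont' : Continuous (H' y) :=
      hH'.continuous.comp (Continuous.prodMk continuous_const continuous_id)
    refine intervalIntegral.hasFDerivAt_integral_of_dominated_of_fderiv_le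
      (bound := fun _ => C) (Metric.closedBall_mem_nhds y one_pos)
      (Filter.Eventually.of_forall fun z => (hcont z).aestronglyMeasurable)
      ((hcont y).intervalIntegrable _ _) hcont'.aestronglyMeasurable
      (Filter.Eventually.of_forall fun t ht z hz => ?_) intervalIntegrable_const
      (Filter.Eventually.of_forall fun t _ z _ => hd z t)
    exact hC (z, t) ⟨hz, Set.uIoc_subset_uIcc ht⟩

namespace GlobalHypo

open MeasureTheory

/-! ### One-parameter subgroups -/

theorem expSU_add (X : su2) (s t : ℝ) :
    expSU ((s + t) • X) = expSU (s • X) * expSU (t • X) := by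
  apply Subtype.ext
  change NormedSpace.exp ((s + t) • (X : Mat2)) =
    NormedSpace.exp (s • (X : Mat2)) * NormedSpace.exp (t • (X : Mat2))
  rw [add_smul, Matrix.exp_add_of_commute]
  exact ((Commute.refl _).smul_left s).smul_right t

@[simp] theorem expSU_zero_smul (X : su2) : expSU ((0 : ℝ) • X) = 1 := by
  apply Subtype.ext
  change NormedSpace.exp ((0 : ℝ) • (X : Mat2)) = 1
  rw [zero_smul, NormedSpace.exp_zero]

/-- Cayley–Hamilton: the trace is zero, so the characteristic polynomial is `T² + 1/4`. -/
theorem sq_of_det {X : su2} (hX : (X : Mat2).det = 1 / 4) :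
    (X : Mat2) * (X : Mat2) = -(1 / 4 : ℂ) • (1 : Mat2) := by
  obtain ⟨-, ht⟩ := X.2
  have h := Matrix.aeval_self_charpoly (X : Mat2)
  rw [Matrix.charpoly_fin_two, ht, hX] at h
  simp only [map_zero, zero_mul, sub_zero, map_add, map_mul, Polynomial.aeval_X,
    Polynomial.aeval_C, pow_two] at h
  rw [eq_neg_of_add_eq_zero_left h, Algebra.algebraMap_eq_smul_one, neg_smul]

open scoped Matrix.Norms.Operator in
/-- The one-parameter subgroup of a normalised element of `su(2)`. -/
theorem coe_expSU_smul {X : su2} (hX : (X : Mat2).det = 1 / 4) (t : ℝ) :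
    ((expSU (t • X) : SU2) : Mat2) =
      Real.cos (t / 2) • (1 : Mat2) + (2 * Real.sin (t / 2)) • (X : Mat2) := by
  set Y : Mat2 := (X : Mat2)
  let G : ℝ → Mat2 := fun t => Real.cos (t / 2) • (1 : Mat2) + (2 * Real.sin (t / 2)) • Y
  have hG : ∀ t, HasDerivAt G (Y * G t) t := by
    intro t
    have h1 : HasDerivAt (fun t : ℝ => Real.cos (t / 2)) (-Real.sin (t / 2) * (1 / 2)) t :=
      ((hasDerivAt_id t).div_const 2).cos
    have h2 : HasDerivAt (fun t : ℝ => 2 * Real.sin (t / 2))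
        (2 * (Real.cos (t / 2) * (1 / 2))) t :=
      (((hasDerivAt_id t).div_const 2).sin).const_mul 2
    refine ((h1.smul_const (1 : Mat2)).add (h2.smul_const Y)).congr_deriv ?_
    have hY : Y * Y = -(1 / 4 : ℂ) • (1 : Mat2) := sq_of_det hX
    have hY' : Y * Y = (-(1 / 4 : ℝ)) • (1 : Mat2) := by
      rw [hY]; ext i j; simp [Complex.real_smul]
    change _ = Y * (Real.cos (t / 2) • (1 : Mat2) + (2 * Real.sin (t / 2)) • Y)
    rw [mul_add, mul_smul_comm, mul_smul_comm, mul_one, hY', smul_smul, add_comm]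
    congr 2 <;> ring
  have hE : ∀ t : ℝ, HasDerivAt (fun t : ℝ => NormedSpace.exp (t • (-Y)))
      (NormedSpace.exp (t • (-Y)) * (-Y)) t := fun t => hasDerivAt_exp_smul_const (𝕂 := ℝ) (-Y) t
  -- Both `G` and the exponential solve `G' = Y G`; uniqueness follows since `exp(-tY) G(t)` has
  -- zero derivative and equals `1` at `0`.
  have hc : ∀ t : ℝ, HasDerivAt (fun t : ℝ => NormedSpace.exp (t • (-Y)) * G t) 0 t := by
    intro t
    refine ((hE t).mul (hG t)).congr_deriv ?_
    rw [mul_assoc, ← mul_add, neg_mul, neg_add_cancel, mul_zero]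
  have hconst := is_const_of_deriv_eq_zero (fun t => (hc t).differentiableAt)
    (fun t => (hc t).deriv) t 0
  have h0 : NormedSpace.exp ((0 : ℝ) • (-Y)) * G 0 = 1 := by simp [G]
  rw [h0] at hconst
  change NormedSpace.exp (t • Y) = G t
  calc NormedSpace.exp (t • Y)
      = NormedSpace.exp (t • Y) * (NormedSpace.exp (t • (-Y)) * G t) := by rw [hconst, mul_one]
    _ = NormedSpace.exp (t • Y + t • (-Y)) * G t := by
        rw [← mul_assoc, Matrix.exp_add_of_commute]
        rw [smul_neg]
        exact Commute.neg_right (Commute.refl _)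
    _ = G t := by rw [smul_neg, add_neg_cancel, NormedSpace.exp_zero, one_mul]

/-- The half angle in `coe_expSU_smul` makes the period `4π`, which is the source of the
half-integers in the spectrum. -/
theorem expSU_four_pi {X : su2} (hX : (X : Mat2).det = 1 / 4) :
    expSU ((4 * Real.pi) • X) = 1 := by
  apply Subtype.ext
  rw [coe_expSU_smul hX]
  have : 4 * Real.pi / 2 = 2 * Real.pi := by ring
  simp [this]

/-- The group law moves the base point to `x * expSU (t • X)`, where the derivative at time `0` is
known. -/
theorem hasDerivAt_flow (f : Smooth) (X : su2) (x : SU2) (t : ℝ) :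
    HasDerivAt (fun t : ℝ => (f : SU2 → ℂ) (x * expSU (t • X)))
      ((lieDeriv X f : SU2 → ℂ) (x * expSU (t • X))) t := by
  have h := smooth_hasDerivAt f X (x * expSU (t • X))
  have h2 : HasDerivAt (fun s : ℝ => s - t) 1 t := (hasDerivAt_id t).sub_const t
  rw [← sub_self t] at h
  have h3 := HasDerivAt.scomp (h := fun s : ℝ => s - t) t h h2
  rw [one_smul] at h3
  refine h3.congr_of_eventuallyEq (Filter.Eventually.of_forall fun s => ?_)
  simp only [Function.comp]
  rw [mul_assoc, ← expSU_add, add_sub_cancel]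

theorem continuous_expSU_smul (X : su2) : Continuous fun t : ℝ => expSU (t • X) := by
  refine continuous_induced_rng.2 ?_
  refine continuous_pi fun i => continuous_pi fun j => ?_
  refine continuous_iff_continuousAt.2 fun t => ?_
  let f : Smooth := ⟨fun x => (x : Mat2) i j, fun y => y i j,
    contDiff_apply_apply ℝ ℂ i j, fun _ => rfl⟩
  have := (hasDerivAt_flow f X 1 t).continuousAt
  simpa [f] using this

theorem lieDeriv_smul (X : su2) (s : ℝ) (f : Smooth) :
    lieDeriv (s • X) f = (s : ℂ) • lieDeriv X f := by
  apply Subtype.ext; funext x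
  change derivAlong (s • X) f x = (s : ℂ) * derivAlong X f x
  have h := smooth_hasDerivAt f X x
  have h2 : HasDerivAt (fun t : ℝ => t * s) s 0 := by
    simpa using (hasDerivAt_id (0 : ℝ)).mul_const s
  have h3 := HasDerivAt.scomp_of_eq (0 : ℝ) h h2 (by simp)
  have h4 := h3.deriv
  simp only [Function.comp_def] at h4
  simpa only [derivAlong, smul_smul, Complex.real_smul] using h4

/-- The determinant of `X` is `|a|² + |b|²` for its first row `(a, b)`, so it is positive unless `X
= 0` and can be scaled to `1/4`. The zero matrix is `0 • Y3`. -/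
theorem exists_eq_smul (X : su2) :
    ∃ (s : ℝ) (Y : su2), (Y : Mat2).det = 1 / 4 ∧ X = s • Y := by
  obtain ⟨hs, ht⟩ := X.2
  have h00 := congrFun (congrFun hs 0) 0
  have h01 := congrFun (congrFun hs 0) 1
  have h10 := congrFun (congrFun hs 1) 0
  rw [Matrix.trace_fin_two] at ht
  simp only [Matrix.star_apply, Matrix.neg_apply] at h00 h01 h10
  have e11 : (X : Mat2) 1 1 = - (X : Mat2) 0 0 := by linear_combination ht
  set a := (X : Mat2) 0 0
  set b := (X : Mat2) 0 1
  have e10 : (X : Mat2) 1 0 = - star b := by rw [h10, neg_neg]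
  have hdet : (X : Mat2).det = ((Complex.normSq a + Complex.normSq b : ℝ) : ℂ) := by
    rw [Matrix.det_fin_two, e11, e10]
    push_cast
    rw [← Complex.mul_conj, ← Complex.mul_conj]
    have : (starRingEnd ℂ) a = -a := h00
    rw [this]
    simp only [RCLike.star_def]
    change a * -a - b * _ = _
    ring
  by_cases h : Complex.normSq a + Complex.normSq b = 0
  · refine ⟨0, Y3, ?_, ?_⟩
    · simp only [Y3, Matrix.det_fin_two_of]
      linear_combination -(1 / 4 : ℂ) * Complex.I_mul_I
    · have ha : a = 0 := by
        have := Complex.normSq_nonneg a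
        have := Complex.normSq_nonneg b
        exact Complex.normSq_eq_zero.1 (by linarith)
      have hb : b = 0 := by
        have := Complex.normSq_nonneg a
        have := Complex.normSq_nonneg b
        exact Complex.normSq_eq_zero.1 (by linarith)
      rw [zero_smul]
      apply Subtype.ext
      ext i j
      fin_cases i <;> fin_cases j
      · exact ha
      · exact hb
      · change (X : Mat2) 1 0 = 0
        rw [e10, hb, star_zero, neg_zero]
      · change (X : Mat2) 1 1 = 0
        rw [e11, ha, neg_zero]
  · have hpos : 0 < Complex.normSq a + Complex.normSq b :=
      lt_of_le_of_ne (add_nonneg (Complex.normSq_nonneg _) (Complex.normSq_nonneg _)) (Ne.symm h)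
    set d := Complex.normSq a + Complex.normSq b
    have hsq : √d ≠ 0 := (Real.sqrt_pos.2 hpos).ne'
    refine ⟨2 * √d, (1 / (2 * √d)) • X, ?_, ?_⟩
    · have hc : (((1 / (2 * √d)) • X : su2) : Mat2) =
          (((1 / (2 * √d) : ℝ)) : ℂ) • (X : Mat2) := by
        ext i j; simp [Complex.real_smul]
      rw [hc, Matrix.det_smul, hdet]
      have : (1 / (2 * √d)) ^ 2 * d = 1 / 4 := by
        rw [div_pow, mul_pow, Real.sq_sqrt hpos.le]; field_simp; norm_num
      rw [Fintype.card_fin, ← Complex.ofReal_pow, ← Complex.ofReal_mul, this]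
      norm_num
    · rw [smul_smul, mul_one_div_cancel (by positivity), one_smul]

/-! ### Invariance of the Haar measure -/

instance : haar.IsHaarMeasure := by unfold haar; infer_instance

instance : haar.IsMulRightInvariant where
  map_mul_right_eq_self g := by
    -- The right translate is again a left Haar probability measure, and such a measure is unique.
    have : IsProbabilityMeasure (Measure.map (· * g) haar) :=
      Measure.isProbabilityMeasure_map (measurable_mul_const g).aemeasurable
    exact Measure.isHaarMeasure_eq_of_isProbabilityMeasure _ _

theorem smooth_integrable (f : Smooth) : Integrable (f : SU2 → ℂ) haar :=
  (smooth_continuous f).integrable_of_hasCompactSupport (HasCompactSupport.of_compactSpace _)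

/-- By right invariance `t ↦ ∫ f(x exp(tX)) dx` is constant; differentiate it under the integral at
`0`. -/
theorem integral_lieDeriv (X : su2) (f : Smooth) :
    ∫ x, (lieDeriv X f : SU2 → ℂ) x ∂haar = 0 := by
  obtain ⟨C, -, hC⟩ := smooth_bounded (lieDeriv X f)
  have h := hasDerivAt_integral_of_dominated_loc_of_deriv_le (μ := haar) (x₀ := (0 : ℝ))
    (F := fun t x => (f : SU2 → ℂ) (x * expSU (t • X)))
    (F' := fun t x => (lieDeriv X f : SU2 → ℂ) (x * expSU (t • X))) (bound := fun _ => C)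
    (s := Set.univ) Filter.univ_mem
    (Filter.Eventually.of_forall fun t =>
      ((smooth_continuous f).comp (continuous_mul_const _)).aestronglyMeasurable)
    (by simpa only [expSU_zero_smul, mul_one] using smooth_integrable f)
    ((smooth_continuous (lieDeriv X f)).comp (continuous_mul_const _)).aestronglyMeasurable
    (Filter.Eventually.of_forall fun x t _ => hC _) (integrable_const _)
    (Filter.Eventually.of_forall fun x t _ => hasDerivAt_flow f X x t)
  have h2 := h.2
  simp only [integral_mul_right_eq_self (μ := haar) (f : SU2 → ℂ),
    integral_mul_right_eq_self (μ := haar) (lieDeriv X f : SU2 → ℂ)] at h2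
  exact h2.unique (hasDerivAt_const _ _)

theorem integral_lieDeriv_mul (X : su2) (f g : Smooth) :
    ∫ x, (lieDeriv X f : SU2 → ℂ) x * (g : SU2 → ℂ) x ∂haar =
      -∫ x, (f : SU2 → ℂ) x * (lieDeriv X g : SU2 → ℂ) x ∂haar := by
  have h := integral_lieDeriv X (f * g)
  rw [lieDeriv_mul] at h
  change ∫ x, (lieDeriv X f : SU2 → ℂ) x * (g : SU2 → ℂ) x +
    (f : SU2 → ℂ) x * (lieDeriv X g : SU2 → ℂ) x ∂haar = 0 at h
  rw [integral_add (integrable_mul _ _) (integrable_mul _ _)] at h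
  exact eq_neg_of_add_eq_zero_left h

/-- A smooth function orthogonal to all smooth functions vanishes. -/
theorem eq_zero_of_integral_mul_eq_zero (f : Smooth)
    (h : ∀ φ : Smooth, ∫ x, (f : SU2 → ℂ) x * (φ : SU2 → ℂ) x ∂haar = 0) : f = 0 := by
  -- The test function is the complex conjugate of `f`, which turns the pairing into `∫ |f|²`.
  have hstar : (fun x => (starRingEnd ℂ) ((f : SU2 → ℂ) x)) ∈ Smooth := by
    obtain ⟨F, hF, hf⟩ := f.2
    exact ⟨fun y => (starRingEnd ℂ) (F y), Complex.conjCLE.contDiff.comp hF, fun x => by simp [hf]⟩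
  have h1 := h ⟨_, hstar⟩
  simp only [Complex.mul_conj] at h1
  rw [integral_complex_ofReal, Complex.ofReal_eq_zero] at h1
  have hcont : Continuous fun x => Complex.normSq ((f : SU2 → ℂ) x) :=
    Complex.continuous_normSq.comp (smooth_continuous f)
  apply Subtype.ext; funext x
  by_contra hx
  exact (hcont.integral_pos_of_hasCompactSupport_nonneg_nonzero (μ := haar) (x := x)
    (HasCompactSupport.of_compactSpace _) (fun x => Complex.normSq_nonneg _)
    (fun h => hx (Complex.normSq_eq_zero.1 h))).ne' h1

/-! ### Linear functions of the matrix entries -/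

/-- The element `(i/2) [[0, 1], [1, 0]]` of `su(2)`. -/
def Y1 : su2 :=
  ⟨!![0, Complex.I / 2; Complex.I / 2, 0], by
    constructor
    · ext i j
      fin_cases i <;> fin_cases j <;> simp [Matrix.star_apply, neg_div]
    · simp [Matrix.trace, Fin.sum_univ_two]⟩

/-- The element `(1/2) [[0, 1], [-1, 0]]` of `su(2)`. -/
def Y2 : su2 :=
  ⟨!![0, 1 / 2; -(1 / 2), 0], by
    constructor
    · ext i j
      fin_cases i <;> fin_cases j <;> simp [Matrix.star_apply]
    · simp [Matrix.trace, Fin.sum_univ_two]⟩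

/-- The smooth function `x ↦ tr (x A)`. -/
def traceFun (A : Mat2) : Smooth :=
  ⟨fun x => ((x : Mat2) * A).trace, fun y => ∑ i, ∑ j, y i j * A j i,
    ContDiff.sum fun i _ => ContDiff.sum fun j _ =>
      (contDiff_apply_apply ℝ ℂ i j).mul contDiff_const,
    fun x => by simp [Matrix.trace, Matrix.mul_apply, entries]⟩

@[simp] theorem traceFun_apply (A : Mat2) (x : SU2) :
    (traceFun A : SU2 → ℂ) x = ((x : Mat2) * A).trace := rfl

theorem lieDeriv_traceFun (Z : su2) (A : Mat2) :
    lieDeriv Z (traceFun A) = traceFun ((Z : Mat2) * A) := by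
  apply Subtype.ext; funext x
  refine HasDerivAt.deriv (f := fun t : ℝ => (traceFun A : SU2 → ℂ) (x * expSU (t • Z))) ?_
  have h := hasDerivAt_entries Z x
  have h2 : HasDerivAt (fun t : ℝ => ∑ i, ∑ j, entries (x * expSU (t • Z)) i j * A j i)
      (∑ i, ∑ j, ((x : Mat2) * (Z : Mat2)) i j * A j i) 0 :=
    HasDerivAt.fun_sum fun i _ => HasDerivAt.fun_sum fun j _ =>
      (hasDerivAt_pi.1 (hasDerivAt_pi.1 h i) j).mul_const _
  simp only [traceFun_apply, ← Matrix.mul_assoc]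
  exact h2

theorem su2_val_mul_star (x : SU2) : (x : Mat2) * star (x : Mat2) = 1 :=
  (Unitary.mem_iff.1 (Matrix.specialUnitaryGroup_le_unitaryGroup x.2)).2

/-- A smooth function which vanishes wherever `x` does not commute with a nonzero `X ∈ su(2)`
is zero. -/
theorem eq_zero_of_mul_traceFun {X : su2} (hX : (X : Mat2).det = 1 / 4) (f : Smooth)
    (h : ∀ A : Mat2, f * traceFun ((X : Mat2) * A - A * (X : Mat2)) = 0) : f = 0 := by
  apply Subtype.ext; funext x
  by_contra hx
  change (f : SU2 → ℂ) x ≠ 0 at hx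
  have key : ∀ A : Mat2, (X : Mat2) * A - A * (X : Mat2) = 0 := by
    intro A
    set B := (X : Mat2) * A - A * (X : Mat2)
    have h0 : ((x : Mat2) * B).trace = 0 :=
      (mul_eq_zero.1 (congrFun (congrArg Subtype.val (h A)) x)).resolve_left hx
    -- Differentiating `f * traceFun B = 0` along `Z` at `x`: the term containing `lieDeriv Z f`
    -- drops out by `h0`.
    have h1 : ∀ Z : su2, ((x : Mat2) * ((Z : Mat2) * B)).trace = 0 := by
      intro Z
      have e := congrArg (lieDeriv Z) (h A)
      rw [lieDeriv_mul, map_zero, lieDeriv_traceFun] at e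
      have e2 : (lieDeriv Z f : SU2 → ℂ) x * ((x : Mat2) * B).trace +
          (f : SU2 → ℂ) x * ((x : Mat2) * ((Z : Mat2) * B)).trace = 0 :=
        congrFun (congrArg Subtype.val e) x
      rw [h0, mul_zero, zero_add] at e2
      exact (mul_eq_zero.1 e2).resolve_left hx
    -- `1, Y1, Y2, Y3` span all `2 × 2` matrices over `ℂ`, so `B * x` is orthogonal to everything
    -- for the trace pairing.
    have hM : B * (x : Mat2) = 0 := by
      have g : ∀ Z : Mat2, ((x : Mat2) * (Z * B)).trace = (Z * (B * (x : Mat2))).trace := by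
        intro Z; rw [Matrix.trace_mul_comm, Matrix.mul_assoc]
      rw [Matrix.trace_mul_comm] at h0
      simp only [g] at h1
      set M := B * (x : Mat2)
      have k1 := h1 Y1
      have k2 := h1 Y2
      have k3 := h1 Y3
      simp only [Y1, Y2, Y3, Matrix.trace_fin_two, Matrix.mul_apply, Fin.sum_univ_two,
        Matrix.of_apply, Matrix.cons_val', Matrix.cons_val_zero, Matrix.cons_val_one,
        Matrix.cons_val_fin_one] at k1 k2 k3 h0
      have hI := Complex.I_mul_I
      ext i j
      fin_cases i <;> fin_cases j <;>
        simp only [Fin.zero_eta, Fin.mk_one, Fin.isValue, Matrix.zero_apply]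
      · linear_combination (1 / 2) * h0 - Complex.I * k3 + (1 / 2) * (M 0 0 - M 1 1) * hI
      · linear_combination -k2 - Complex.I * k1 + (1 / 2) * (M 0 1 + M 1 0) * hI
      · linear_combination k2 - Complex.I * k1 + (1 / 2) * (M 0 1 + M 1 0) * hI
      · linear_combination (1 / 2) * h0 + Complex.I * k3 - (1 / 2) * (M 0 0 - M 1 1) * hI
    calc B = B * ((x : Mat2) * star (x : Mat2)) := by rw [su2_val_mul_star, mul_one]
      _ = 0 := by rw [← mul_assoc, hM, zero_mul]
  have ht := X.2.2
  rw [Matrix.trace_fin_two] at ht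
  -- Commuting with both off-diagonal matrix units makes `X` scalar; having trace zero it would
  -- vanish, contrary to its determinant.
  have k1 := key !![0, 1; 0, 0]
  have k2 := key !![0, 0; 1, 0]
  have a1 := congrFun (congrFun k1 0) 0
  have a2 := congrFun (congrFun k1 0) 1
  have a3 := congrFun (congrFun k2 0) 0
  simp only [Matrix.sub_apply, Matrix.mul_apply, Fin.sum_univ_two, Matrix.of_apply,
    Matrix.cons_val', Matrix.cons_val_zero, Matrix.cons_val_one, Matrix.cons_val_fin_one,
    Matrix.zero_apply, mul_zero, mul_one, zero_mul, one_mul, zero_add, add_zero, zero_sub,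
    sub_zero, neg_eq_zero] at a1 a2 a3
  rw [Matrix.det_fin_two, a1, a3] at hX
  have h4 : (X : Mat2) 0 0 = 0 := by linear_combination (1 / 2) * ht + (1 / 2) * a2
  rw [h4] at hX
  norm_num at hX

/-! ### Eigendistributions carried by a circle -/

theorem norm_exp_I_mul_div_two (l : ℤ) (t : ℝ) :
    ‖Complex.exp (Complex.I * (l : ℂ) / 2 * t)‖ = 1 := by
  rw [show Complex.I * (l : ℂ) / 2 * t = ((l / 2 * t : ℝ) : ℂ) * Complex.I by push_cast; ring]
  exact Complex.norm_exp_ofReal_mul_I _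

theorem continuous_circle_integrand (X : su2) (l : ℤ) (φ : Smooth) :
    Continuous fun t : ℝ =>
      Complex.exp (Complex.I * (l : ℂ) / 2 * t) * (φ : SU2 → ℂ) (expSU (t • X)) :=
  (by fun_prop : Continuous fun t : ℝ => Complex.exp (Complex.I * (l : ℂ) / 2 * t)).mul
    ((smooth_continuous φ).comp (continuous_expSU_smul X))

/-- The functional `φ ↦ ∫₀^{4π} e^{ilt/2} φ(exp(tX)) dt`. -/
def circleFunctional (X : su2) (l : ℤ) : Smooth →ₗ[ℂ] ℂ where
  toFun φ := ∫ t in (0 : ℝ)..(4 * Real.pi),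
    Complex.exp (Complex.I * (l : ℂ) / 2 * t) * (φ : SU2 → ℂ) (expSU (t • X))
  map_add' φ ψ := by
    rw [← intervalIntegral.integral_add
      ((continuous_circle_integrand X l φ).intervalIntegrable _ _)
      ((continuous_circle_integrand X l ψ).intervalIntegrable _ _)]
    exact intervalIntegral.integral_congr fun t _ => mul_add _ _ _
  map_smul' c φ := by
    rw [RingHom.id_apply, smul_eq_mul, ← intervalIntegral.integral_const_mul]
    exact intervalIntegral.integral_congr fun t _ => mul_left_comm _ _ _

/-- The distribution `φ ↦ ∫₀^{4π} e^{ilt/2} φ(exp(tX)) dt`. -/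
def circleDistribution (X : su2) (l : ℤ) : Distribution :=
  ⟨circleFunctional X l, by
    refine ⟨{[]}, 4 * Real.pi, fun φ M h => ?_⟩
    have := intervalIntegral.norm_integral_le_of_norm_le_const (a := 0) (b := 4 * Real.pi) (C := M)
      (f := fun t : ℝ =>
        Complex.exp (Complex.I * (l : ℂ) / 2 * t) * (φ : SU2 → ℂ) (expSU (t • X)))
      (fun t _ => by
        rw [norm_mul, norm_exp_I_mul_div_two, one_mul]
        exact h [] (by simp) _)
    rw [sub_zero, abs_of_pos (by positivity), mul_comm M] at this
    exact this⟩

/-- Integration by parts on `[0, 4π]`: both factors have period `4π`, so the boundary terms cancel.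
-/
theorem distDeriv_circleDistribution {X : su2} (hX : (X : Mat2).det = 1 / 4) (l : ℤ) :
    distDeriv X (circleDistribution X l) =
      (Complex.I * (l : ℂ) / 2) • circleDistribution X l := by
  apply Subtype.ext; ext φ
  change -(∫ t in (0 : ℝ)..(4 * Real.pi), Complex.exp (Complex.I * (l : ℂ) / 2 * t) *
      (lieDeriv X φ : SU2 → ℂ) (expSU (t • X))) =
    (Complex.I * (l : ℂ) / 2) * ∫ t in (0 : ℝ)..(4 * Real.pi),
      Complex.exp (Complex.I * (l : ℂ) / 2 * t) * (φ : SU2 → ℂ) (expSU (t • X))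
  set μ := Complex.I * (l : ℂ) / 2 with hμ
  have hexp : ∀ t : ℝ, HasDerivAt (fun t : ℝ => Complex.exp (μ * t)) (Complex.exp (μ * t) * μ) t := by
    intro t
    have : HasDerivAt (fun t : ℝ => μ * (t : ℂ)) (μ * 1) t :=
      (HasDerivAt.ofReal_comp (hasDerivAt_id t)).const_mul μ
    rw [mul_one] at this
    exact this.cexp
  have hφ : ∀ t : ℝ, HasDerivAt (fun t : ℝ => (φ : SU2 → ℂ) (expSU (t • X)))
      ((lieDeriv X φ : SU2 → ℂ) (expSU (t • X))) t := fun t => by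
    simpa only [one_mul] using hasDerivAt_flow φ X 1 t
  have hc := (continuous_circle_integrand X l φ)
  have hc' := (continuous_circle_integrand X l (lieDeriv X φ))
  rw [← hμ] at hc hc'
  have hcμ : Continuous fun t : ℝ =>
      Complex.exp (μ * t) * μ * (φ : SU2 → ℂ) (expSU (t • X)) :=
    (hc.const_mul μ).congr fun t => by ring
  have h := intervalIntegral.integral_eq_sub_of_hasDerivAt (a := 0) (b := 4 * Real.pi)
    (fun t _ => (hexp t).mul (hφ t))
    ((hcμ.add hc').intervalIntegrable _ _)
  have hper : Complex.exp (μ * ((4 * Real.pi : ℝ) : ℂ)) = 1 := by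
    rw [Complex.exp_eq_one_iff]
    exact ⟨l, by rw [hμ]; push_cast; ring⟩
  rw [Pi.mul_apply, Pi.mul_apply, hper, expSU_four_pi hX, expSU_zero_smul] at h
  rw [intervalIntegral.integral_add
    (hcμ.intervalIntegrable _ _) (hc'.intervalIntegrable _ _)] at h
  simp only [Complex.ofReal_zero, mul_zero, Complex.exp_zero, sub_self] at h
  rw [← eq_neg_of_add_eq_zero_left h, ← intervalIntegral.integral_const_mul]
  exact intervalIntegral.integral_congr fun t _ => by ring

/-- On the circle, `tr(x (1/2 + aX))` restricts to `cos(t/2) - a sin(t/2)`. The choices `a = ∓i`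
give `e^{±it/2}`, and powers give every `l`. With `-l` in place of `l` this is a test function on
which the circle distribution takes the value `4π`. -/
theorem exists_smooth_character {X : su2} (hX : (X : Mat2).det = 1 / 4) (l : ℤ) :
    ∃ φ : Smooth, ∀ t : ℝ,
      (φ : SU2 → ℂ) (expSU (t • X)) = Complex.exp (Complex.I * (l : ℂ) / 2 * t) := by
  have hval : ∀ (a : ℂ) (t : ℝ),
      (traceFun ((1 / 2 : ℂ) • 1 + a • (X : Mat2)) : SU2 → ℂ) (expSU (t • X)) =
        Real.cos (t / 2) - a * Real.sin (t / 2) := by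
    intro a t
    have ht : (X : Mat2).trace = 0 := X.2.2
    rw [traceFun_apply, coe_expSU_smul hX]
    simp only [Matrix.add_mul, Matrix.mul_add, Matrix.smul_mul, Matrix.mul_smul, Matrix.one_mul,
      Matrix.mul_one, sq_of_det hX, Matrix.trace_add, Matrix.trace_smul, ht, Matrix.trace_one,
      Fintype.card_fin, Complex.real_smul, smul_eq_mul]
    push_cast
    ring
  have hnat : ∀ (n : ℕ) (s : ℤ), s = 1 ∨ s = -1 → ∃ φ : Smooth, ∀ t : ℝ,
      (φ : SU2 → ℂ) (expSU (t • X)) = Complex.exp (Complex.I * ((s * n : ℤ) : ℂ) / 2 * t) := by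
    intro n s hs
    refine ⟨traceFun ((1 / 2 : ℂ) • 1 + (-(s : ℂ) * Complex.I) • (X : Mat2)) ^ n, fun t => ?_⟩
    have e : Complex.exp (Complex.I * ((s * n : ℤ) : ℂ) / 2 * t) =
        Complex.exp (((s * t / 2 : ℝ) : ℂ) * Complex.I) ^ n := by
      rw [← Complex.exp_nat_mul]; congr 1; push_cast; ring
    change ((traceFun ((1 / 2 : ℂ) • 1 + (-(s : ℂ) * Complex.I) • (X : Mat2)) : SU2 → ℂ)
      (expSU (t • X))) ^ n = _
    rw [hval, e, Complex.exp_mul_I, ← Complex.ofReal_cos, ← Complex.ofReal_sin]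
    congr 1
    rcases hs with rfl | rfl
    · simp; ring
    · have : ((-1 : ℤ) : ℝ) * t / 2 = -(t / 2) := by push_cast; ring
      rw [this, Real.cos_neg, Real.sin_neg]; simp; ring
  obtain ⟨n, rfl | rfl⟩ := l.eq_nat_or_neg
  · simpa using hnat n 1 (Or.inl rfl)
  · simpa using hnat n (-1) (Or.inr rfl)

theorem circleDistribution_ne_zero {X : su2} (hX : (X : Mat2).det = 1 / 4) (l : ℤ) :
    circleDistribution X l ≠ 0 := by
  intro h0
  obtain ⟨φ, hφ⟩ := exists_smooth_character hX (-l)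
  have h1 : (∫ t in (0 : ℝ)..(4 * Real.pi), Complex.exp (Complex.I * (l : ℂ) / 2 * t) *
      (φ : SU2 → ℂ) (expSU (t • X))) = 0 :=
    congrArg (fun u : Distribution => (u : Smooth →ₗ[ℂ] ℂ) φ) h0
  have h2 : ∀ t : ℝ, Complex.exp (Complex.I * (l : ℂ) / 2 * t) *
      (φ : SU2 → ℂ) (expSU (t • X)) = 1 := by
    intro t
    rw [hφ, ← Complex.exp_add, Complex.exp_eq_one_iff]
    exact ⟨0, by push_cast; ring⟩
  simp [h2, Real.pi_ne_zero] at h1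

/-- The functions `tr(x [X, A])` vanish on the circle, as its points commute with `X`. They
therefore annihilate the distribution, and a density `f` would satisfy `f * tr(x [X, A]) = 0` for
all `A`. This forces `f = 0`, while the distribution is nonzero. -/
theorem not_isSmooth_circleDistribution {X : su2} (hX : (X : Mat2).det = 1 / 4) (l : ℤ) :
    ¬ IsSmooth (circleDistribution X l) := by
  rintro ⟨f, hf⟩
  have hpair : ∀ φ : Smooth, (circleDistribution X l : Smooth →ₗ[ℂ] ℂ) φ =
      ∫ x, (f : SU2 → ℂ) x * (φ : SU2 → ℂ) x ∂haar := fun φ => by rw [hf]; rfl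
  have hzero : f = 0 := by
    refine eq_zero_of_mul_traceFun hX f fun A => eq_zero_of_integral_mul_eq_zero _ fun φ => ?_
    set ψ := traceFun ((X : Mat2) * A - A * (X : Mat2)) with hψ
    have h1 := hpair (ψ * φ)
    have h2 : (circleDistribution X l : Smooth →ₗ[ℂ] ℂ) (ψ * φ) = 0 := by
      have hv : ∀ t : ℝ, (ψ : SU2 → ℂ) (expSU (t • X)) = 0 := by
        intro t
        have hcomm : (X : Mat2) * ((expSU (t • X) : SU2) : Mat2) =
            ((expSU (t • X) : SU2) : Mat2) * (X : Mat2) := by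
          rw [coe_expSU_smul hX]; simp [mul_add, add_mul]
        rw [hψ, traceFun_apply, mul_sub, Matrix.trace_sub, ← Matrix.mul_assoc, ← Matrix.mul_assoc,
          Matrix.trace_mul_comm _ (X : Mat2), ← Matrix.mul_assoc, hcomm, sub_self]
      change (∫ t in (0 : ℝ)..(4 * Real.pi), Complex.exp (Complex.I * (l : ℂ) / 2 * t) *
        ((ψ : SU2 → ℂ) (expSU (t • X)) * (φ : SU2 → ℂ) (expSU (t • X)))) = 0
      simp [hv]
    rw [h2] at h1
    rw [h1]
    exact integral_congr_ae (Filter.Eventually.of_forall fun x => mul_assoc _ _ _)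
  refine circleDistribution_ne_zero hX l (Subtype.ext (LinearMap.ext fun φ => ?_))
  rw [hpair, hzero]
  simp

theorem isSmooth_zero : IsSmooth 0 :=
  ⟨0, Subtype.ext (LinearMap.ext fun φ => by
    change 0 = ∫ x, (0 : ℂ) * (φ : SU2 → ℂ) x ∂haar
    simp)⟩

theorem distDeriv_smul (X : su2) (s : ℝ) (u : Distribution) :
    distDeriv (s • X) u = (s : ℂ) • distDeriv X u := by
  apply Subtype.ext; ext φ
  change -((u : Smooth →ₗ[ℂ] ℂ) (lieDeriv (s • X) φ)) =
    (s : ℂ) * -((u : Smooth →ₗ[ℂ] ℂ) (lieDeriv X φ))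
  rw [lieDeriv_smul, map_smul, smul_eq_mul, mul_neg]

theorem not_globallyHypoelliptic_sq_add (X : su2) (a : Smooth) :
    ¬ GloballyHypoelliptic (distDeriv X ^ 2 + distMul a ∘ₗ distDeriv X) := by
  intro h
  obtain ⟨s, Y, hY, rfl⟩ := exists_eq_smul X
  refine not_isSmooth_circleDistribution hY 0 (h _ ?_)
  have h0 : distDeriv (s • Y) (circleDistribution Y 0) = 0 := by
    rw [distDeriv_smul, distDeriv_circleDistribution hY]; simp
  have : (distDeriv (s • Y) ^ 2 + distMul a ∘ₗ distDeriv (s • Y)) (circleDistribution Y 0) = 0 := by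
    rw [LinearMap.add_apply, pow_two, Module.End.mul_apply, LinearMap.comp_apply, h0]; simp
  rw [this]
  exact isSmooth_zero

/-! ### Inverting `∂_X + c` on smooth functions -/

/-- The average `∫₀^{4π} e^{ct} f(x exp(tX)) dt` of a smooth function along a circle. -/
def circleAverage (X : su2) (c : ℂ) (f : SU2 → ℂ) (x : SU2) : ℂ :=
  ∫ t in (0 : ℝ)..(4 * Real.pi), Complex.exp (c * t) * f (x * expSU (t • X))

/-- `Smooth` asks for an extension to all matrices. Right multiplication by `cos(t/2) + 2 sin(t/2)
X` makes sense there and is jointly smooth in the matrix and `t`, so the average of the extension of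
`f` extends the average. -/
theorem circleAverage_mem {X : su2} (hX : (X : Mat2).det = 1 / 4) (c : ℂ) {f : SU2 → ℂ}
    (hf : f ∈ Smooth) : circleAverage X c f ∈ Smooth := by
  obtain ⟨F, hF, hf⟩ := hf
  let T : (Fin 2 → Fin 2 → ℂ) → ℝ → (Fin 2 → Fin 2 → ℂ) := fun y t i j =>
    (Real.cos (t / 2) : ℂ) * y i j + (2 * Real.sin (t / 2) : ℂ) * ∑ k, y i k * (X : Mat2) k j
  have hT : ContDiff ℝ ∞ (Function.uncurry T) := by
    refine contDiff_pi.2 fun i => contDiff_pi.2 fun j => ?_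
    have hy : ∀ i j, ContDiff ℝ ∞ fun p : (Fin 2 → Fin 2 → ℂ) × ℝ => p.1 i j := fun i j =>
      (contDiff_apply_apply ℝ ℂ i j).comp contDiff_fst
    have hcos : ContDiff ℝ ∞ fun p : (Fin 2 → Fin 2 → ℂ) × ℝ => (Real.cos (p.2 / 2) : ℂ) :=
      Complex.ofRealCLM.contDiff.comp (Real.contDiff_cos.comp (contDiff_snd.div_const 2))
    have hsin : ContDiff ℝ ∞ fun p : (Fin 2 → Fin 2 → ℂ) × ℝ => (Real.sin (p.2 / 2) : ℂ) :=
      Complex.ofRealCLM.contDiff.comp (Real.contDiff_sin.comp (contDiff_snd.div_const 2))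
    exact (hcos.mul (hy i j)).add ((contDiff_const.mul hsin).mul
      (ContDiff.sum fun k _ => (hy i k).mul contDiff_const))
  have hTe : ∀ (x : SU2) (t : ℝ), entries (x * expSU (t • X)) = T (entries x) t := by
    intro x t
    funext i j
    change ((x : Mat2) * ((expSU (t • X) : SU2) : Mat2)) i j = _
    rw [coe_expSU_smul hX, mul_add, mul_smul_comm, mul_smul_comm, mul_one]
    simp [T, entries, Matrix.mul_apply, mul_add]
  refine ⟨fun y => ∫ t in (0 : ℝ)..(4 * Real.pi), Complex.exp (c * t) * F (T y t), ?_, fun x => ?_⟩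
  · refine contDiff_infty.2 fun n => contDiff_intervalIntegral_of_contDiff_uncurry _ _ n
      (H := fun y t => Complex.exp (c * t) * F (T y t)) ?_
    refine ContDiff.mul ?_ (hF.comp hT)
    exact (contDiff_const.mul (Complex.ofRealCLM.contDiff.comp contDiff_snd)).cexp
  · simp only [circleAverage, hf, hTe]

/-- The operator `∂_X + c` on smooth functions. -/
def lieDerivAdd (X : su2) (c : ℂ) : Smooth →ₗ[ℂ] Smooth := lieDeriv X + c • LinearMap.id

/-- `e^{ct}` is the integrating factor turning `∂_X + c` into `d/dt` along the flow. -/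
theorem hasDerivAt_exp_mul_flow (f : Smooth) (X : su2) (c : ℂ) (x : SU2) (t : ℝ) :
    HasDerivAt (fun t : ℝ => Complex.exp (c * t) * (f : SU2 → ℂ) (x * expSU (t • X)))
      (Complex.exp (c * t) * (lieDerivAdd X c f : SU2 → ℂ) (x * expSU (t • X)))
      t := by
  have h1 : HasDerivAt (fun t : ℝ => Complex.exp (c * t)) (Complex.exp (c * t) * c) t := by
    have : HasDerivAt (fun t : ℝ => c * (t : ℂ)) (c * 1) t :=
      (HasDerivAt.ofReal_comp (hasDerivAt_id t)).const_mul c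
    rw [mul_one] at this
    exact this.cexp
  refine (h1.mul (hasDerivAt_flow f X x t)).congr_deriv ?_
  change _ = Complex.exp (c * t) * ((lieDeriv X f : SU2 → ℂ) (x * expSU (t • X)) +
    c * (f : SU2 → ℂ) (x * expSU (t • X)))
  ring

theorem continuous_exp_mul_flow (f : Smooth) (X : su2) (c : ℂ) (x : SU2) :
    Continuous fun t : ℝ => Complex.exp (c * t) * (f : SU2 → ℂ) (x * expSU (t • X)) :=
  continuous_iff_continuousAt.2 fun t => (hasDerivAt_exp_mul_flow f X c x t).continuousAt

/-- The solution is the circle average of `f` divided by `e^{4πc} - 1`: applying `∂_X + c` to the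
average leaves only the difference of the endpoint values of `e^{ct} f(x exp(tX))`, which is
`(e^{4πc} - 1) f(x)`. All circles have the same period, so no small divisors occur. -/
theorem exists_lieDerivAdd_eq {X : su2} (hX : (X : Mat2).det = 1 / 4) {c : ℂ}
    (hc : Complex.exp (c * (4 * Real.pi)) ≠ 1) (f : Smooth) :
    ∃ g : Smooth, lieDerivAdd X c g = f := by
  set e := Complex.exp (c * (4 * Real.pi)) with he
  have he0 : e - 1 ≠ 0 := sub_ne_zero.2 hc
  let A : Smooth := ⟨circleAverage X c f, circleAverage_mem hX c f.2⟩
  refine ⟨(e - 1)⁻¹ • A, ?_⟩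
  suffices h : lieDerivAdd X c A = (e - 1) • f by
    rw [map_smul, h, smul_smul, inv_mul_cancel₀ he0, one_smul]
  apply Subtype.ext; funext x
  change derivAlong X (circleAverage X c f) x + c * circleAverage X c f x =
    (e - 1) * (f : SU2 → ℂ) x
  set h : ℝ → ℂ := fun t => Complex.exp (c * t) * (f : SU2 → ℂ) (x * expSU (t • X)) with hh
  have hcont : Continuous h := continuous_exp_mul_flow f X c x
  -- Moving the base point along the flow only shifts the window of integration, up to the factor
  -- `e^{-cs}`; both dependences on `s` can then be differentiated.
  have hshift : ∀ s : ℝ, circleAverage X c f (x * expSU (s • X)) =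
      Complex.exp (-c * s) * ∫ t in s..(s + 4 * Real.pi), h t := by
    intro s
    have := intervalIntegral.integral_comp_add_right (a := 0) (b := 4 * Real.pi) h s
    rw [zero_add, add_comm (4 * Real.pi)] at this
    rw [← this, ← intervalIntegral.integral_const_mul]
    refine intervalIntegral.integral_congr fun t _ => ?_
    simp only [hh]
    rw [← mul_assoc, ← Complex.exp_add, mul_assoc x, ← expSU_add, add_comm s t]
    congr 2
    push_cast; ring
  have hd1 : HasDerivAt (fun s : ℝ => ∫ t in s..(s + 4 * Real.pi), h t)
      (h (4 * Real.pi) - h 0) 0 := by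
    have hF : ∀ r : ℝ, HasDerivAt (fun s => ∫ t in (0 : ℝ)..s, h t) (h r) r := fun r =>
      intervalIntegral.integral_hasDerivAt_right (hcont.intervalIntegrable _ _)
        (hcont.stronglyMeasurableAtFilter _ _) hcont.continuousAt
    have h1 : HasDerivAt (fun s : ℝ => ∫ t in (0 : ℝ)..(s + 4 * Real.pi), h t)
        (h (4 * Real.pi)) 0 := by
      have := (hF (0 + 4 * Real.pi)).comp_add_const 0 (4 * Real.pi)
      rwa [zero_add] at this
    refine (h1.sub (hF 0)).congr_of_eventuallyEq (Filter.Eventually.of_forall fun s => ?_)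
    exact (intervalIntegral.integral_interval_sub_left (hcont.intervalIntegrable _ _)
      (hcont.intervalIntegrable _ _)).symm
  have hd2 : HasDerivAt (fun s : ℝ => Complex.exp (-c * s)) (-c) 0 := by
    have : HasDerivAt (fun t : ℝ => -c * (t : ℂ)) (-c * 1) 0 :=
      (HasDerivAt.ofReal_comp (hasDerivAt_id (0 : ℝ))).const_mul (-c)
    simpa using this.cexp
  have hd := hd2.mul hd1
  have hval : derivAlong X (circleAverage X c f) x = _ :=
    (hd.congr_of_eventuallyEq (Filter.Eventually.of_forall hshift)).deriv
  rw [hval]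
  have h0 : h 0 = (f : SU2 → ℂ) x := by
    simp only [hh, expSU_zero_smul, Complex.ofReal_zero, mul_zero, Complex.exp_zero, one_mul, mul_one]
  have h4 : h (4 * Real.pi) = e * (f : SU2 → ℂ) x := by
    simp only [hh, expSU_four_pi hX, mul_one, he]
    push_cast; rfl
  have hI : circleAverage X c f x = ∫ t in (0 : ℝ)..(0 + 4 * Real.pi), h t := by
    simp only [circleAverage, hh, zero_add]
  rw [h0, h4, hI]
  simp only [Complex.ofReal_zero, mul_zero, Complex.exp_zero]
  ring

/-! ### Global hypoellipticity -/

theorem exp_mul_four_pi_ne_one {c : ℂ} (hc : ¬ ∃ l : ℤ, c = Complex.I * l / 2) :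
    Complex.exp (c * (4 * Real.pi)) ≠ 1 := by
  intro h
  obtain ⟨n, hn⟩ := Complex.exp_eq_one_iff.1 h
  refine hc ⟨n, ?_⟩
  have hpi : (Real.pi : ℂ) ≠ 0 := Complex.ofReal_ne_zero.2 Real.pi_ne_zero
  have h4 : (4 * Real.pi : ℂ) ≠ 0 := mul_ne_zero (by norm_num) hpi
  apply mul_right_cancel₀ h4
  rw [hn]; ring

/-- The condition on `r` is symmetric under `r ↦ -r`. Solvability for `∂_X - r` gives a smooth `g`
with the same image as `u`; solvability for `∂_X + r` writes every test function as `(∂_X + r) ψ`,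
and on these `u` and `g` agree. -/
theorem globallyHypoelliptic_distDeriv_sub {X : su2} (hX : (X : Mat2).det = 1 / 4) {r : ℂ}
    (hr : ¬ ∃ l : ℤ, r = Complex.I * l / 2) :
    GloballyHypoelliptic (distDeriv X - r • LinearMap.id) := by
  rintro u ⟨f, hf⟩
  have hr' : ¬ ∃ l : ℤ, -r = Complex.I * l / 2 := by
    rintro ⟨l, hl⟩
    exact hr ⟨-l, by push_cast; linear_combination -hl⟩
  obtain ⟨g, hg⟩ := exists_lieDerivAdd_eq hX (exp_mul_four_pi_ne_one hr') f
  refine ⟨g, Subtype.ext (LinearMap.ext fun φ => ?_)⟩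
  obtain ⟨ψ, rfl⟩ := exists_lieDerivAdd_eq hX (exp_mul_four_pi_ne_one hr) φ
  have h1 : -((u : Smooth →ₗ[ℂ] ℂ) (lieDeriv X ψ)) - r * (u : Smooth →ₗ[ℂ] ℂ) ψ =
      ∫ x, (f : SU2 → ℂ) x * (ψ : SU2 → ℂ) x ∂haar :=
    LinearMap.congr_fun (congrArg Subtype.val hf) ψ
  have h2 : (u : Smooth →ₗ[ℂ] ℂ) (lieDerivAdd X r ψ) =
      -∫ x, (f : SU2 → ℂ) x * (ψ : SU2 → ℂ) x ∂haar := by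
    rw [← h1, lieDerivAdd, LinearMap.add_apply, map_add, LinearMap.smul_apply, map_smul, LinearMap.id_apply,
      smul_eq_mul]
    ring
  rw [h2]
  have h3 := integral_lieDeriv_mul X g ψ
  have e1 : ∫ x, (f : SU2 → ℂ) x * (ψ : SU2 → ℂ) x ∂haar =
      (∫ x, (lieDeriv X g : SU2 → ℂ) x * (ψ : SU2 → ℂ) x ∂haar) -
        r * ∫ x, (g : SU2 → ℂ) x * (ψ : SU2 → ℂ) x ∂haar := by
    rw [← hg, ← integral_const_mul, ← integral_sub (integrable_mul _ _)
      ((integrable_mul _ _).const_mul r)]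
    refine integral_congr_ae (Filter.Eventually.of_forall fun x => ?_)
    change ((lieDeriv X g : SU2 → ℂ) x + -r * (g : SU2 → ℂ) x) * (ψ : SU2 → ℂ) x = _
    ring
  have e2 : (integralFunctional g) (lieDerivAdd X r ψ) =
      (∫ x, (g : SU2 → ℂ) x * (lieDeriv X ψ : SU2 → ℂ) x ∂haar) +
        r * ∫ x, (g : SU2 → ℂ) x * (ψ : SU2 → ℂ) x ∂haar := by
    rw [lieDerivAdd, LinearMap.add_apply, map_add, LinearMap.smul_apply, map_smul]
    rfl
  change _ = (integralFunctional g) (lieDerivAdd X r ψ)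
  rw [e2, e1, h3]
  ring

theorem IsSmooth.smul {u : Distribution} (hu : IsSmooth u) (c : ℂ) : IsSmooth (c • u) := by
  obtain ⟨f, rfl⟩ := hu
  refine ⟨c • f, Subtype.ext (LinearMap.ext fun φ => ?_)⟩
  change c * (∫ x, (f : SU2 → ℂ) x * (φ : SU2 → ℂ) x ∂haar) =
    ∫ x, c * (f : SU2 → ℂ) x * (φ : SU2 → ℂ) x ∂haar
  rw [← integral_const_mul]
  simp only [mul_assoc]

/-- A polynomial in `∂_X` is globally hypoelliptic precisely if it has no zero in `(i/2)ℤ`. -/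
theorem globallyHypoelliptic_aeval_iff {X : su2} (hX : (X : Mat2).det = 1 / 4)
    (p : Polynomial ℂ) :
    GloballyHypoelliptic (Polynomial.aeval (distDeriv X) p) ↔
      ∀ l : ℤ, p.eval (Complex.I * l / 2) ≠ 0 := by
  constructor
  · intro h l hl
    refine not_isSmooth_circleDistribution hX l (h _ ?_)
    have hev : Module.End.HasEigenvector (distDeriv X) (Complex.I * l / 2)
        (circleDistribution X l) :=
      ⟨Module.End.mem_eigenspace_iff.2 (distDeriv_circleDistribution hX l),
        circleDistribution_ne_zero hX l⟩
    rw [Module.End.aeval_apply_of_hasEigenvector hev, hl, zero_smul]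
    exact isSmooth_zero
  · intro h
    have hp : p ≠ 0 := by
      rintro rfl
      exact h 0 (by simp)
    -- Each linear factor is globally hypoelliptic, so smoothness is pulled back through the product
    -- one factor at a time.
    have hroots : ∀ s : Multiset ℂ, (∀ r ∈ s, ¬ ∃ l : ℤ, r = Complex.I * l / 2) →
        GloballyHypoelliptic (Polynomial.aeval (distDeriv X)
          (s.map fun r => Polynomial.X - Polynomial.C r).prod) := by
      intro s
      induction s using Multiset.induction_on with
      | empty => intro _ u hu; simpa using hu
      | cons r s ih =>
        intro hs u hu
        refine ih (fun r' hr' => hs r' (Multiset.mem_cons_of_mem hr')) u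
          (globallyHypoelliptic_distDeriv_sub hX (hs r (Multiset.mem_cons_self r s)) _ ?_)
        rw [Multiset.map_cons, Multiset.prod_cons, map_mul, Module.End.mul_apply] at hu
        convert hu using 2
        rw [map_sub, Polynomial.aeval_X, Polynomial.aeval_C]
        rfl
    intro u hu
    have hfac := (IsAlgClosed.splits p).eq_prod_roots
    have hlc : p.leadingCoeff ≠ 0 := Polynomial.leadingCoeff_ne_zero.2 hp
    refine hroots p.roots ?_ u ?_
    · rintro r hr ⟨l, rfl⟩
      exact h l (Polynomial.isRoot_of_mem_roots hr)
    · rw [hfac, map_mul, Polynomial.aeval_C, Module.End.mul_apply,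
        Module.algebraMap_end_apply] at hu
      simpa [smul_smul, hlc] using hu.smul p.leadingCoeff⁻¹

theorem globallyHypoelliptic_pow_add_iff {X : su2} (hX : (X : Mat2).det = 1 / 4) (k : ℕ) (c : ℂ) :
    GloballyHypoelliptic (distDeriv X ^ k + c • LinearMap.id) ↔
      ¬ ∃ l : ℤ, c = -(-Complex.I) ^ k * ((l : ℂ) / 2) ^ k := by
  have h : distDeriv X ^ k + c • LinearMap.id =
      Polynomial.aeval (distDeriv X) (Polynomial.X ^ k + Polynomial.C c) := by
    rw [map_add, map_pow, Polynomial.aeval_X, Polynomial.aeval_C]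
    rfl
  -- Replacing `l` by `-l` matches the zeros `il/2` with the form `-i · (l/2)`.
  rw [h, globallyHypoelliptic_aeval_iff hX, not_exists, ← (Equiv.neg ℤ).forall_congr_right]
  refine forall_congr' fun l => not_congr ?_
  simp only [Polynomial.eval_add, Polynomial.eval_pow, Polynomial.eval_X, Polynomial.eval_C,
    Equiv.neg_apply]
  have : Complex.I * ((-l : ℤ) : ℂ) / 2 = -Complex.I * (l / 2) := by push_cast; ring
  rw [this, mul_pow, neg_mul, ← sub_eq_zero (a := c), sub_neg_eq_add, add_comm]

theorem globallyHypoelliptic_add_iff {X : su2} (hX : (X : Mat2).det = 1 / 4) (c : ℂ) :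
    GloballyHypoelliptic (distDeriv X + c • LinearMap.id) ↔
      ¬ ∃ l : ℤ, Complex.I * c = (l : ℂ) / 2 := by
  rw [← pow_one (distDeriv X), globallyHypoelliptic_pow_add_iff hX]
  refine not_congr ((Equiv.neg ℤ).exists_congr fun l => ?_)
  rw [Equiv.neg_apply, Int.cast_neg]
  have hI := Complex.I_mul_I
  constructor
  · rintro rfl
    linear_combination (l / 2 : ℂ) * hI
  · intro h
    linear_combination -Complex.I * h + c * hI

theorem globallyHypoelliptic_sq_add_iff {X : su2} (hX : (X : Mat2).det = 1 / 4) (c : ℂ) :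
    GloballyHypoelliptic (distDeriv X ^ 2 + c • LinearMap.id) ↔
      ¬ ∃ l : ℤ, 4 * c = (l : ℂ) ^ 2 := by
  rw [globallyHypoelliptic_pow_add_iff hX]
  refine not_congr (exists_congr fun l => ?_)
  have hI := Complex.I_mul_I
  constructor
  · rintro rfl
    linear_combination -(l ^ 2 : ℂ) * hI
  · intro h
    linear_combination (1 / 4 : ℂ) * h + (l ^ 2 / 4 : ℂ) * hI

/-! ### Shifted Legendre polynomials -/

open Polynomial in
/-- The shifted Legendre polynomial with complex coefficients. -/
def legendre (n : ℕ) : Polynomial ℂ := (shiftedLegendre n).map (Int.castRingHom ℂ)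

theorem coeff_legendre (n k : ℕ) :
    (legendre n).coeff k = (-1) ^ k * n.choose k * (n + k).choose n := by
  rw [legendre, Polynomial.coeff_map, Polynomial.coeff_shiftedLegendre]
  simp

/-- In this form `n` enters through a single binomial coefficient, so Pascal's rule can compare the
coefficients for `n`, `n + 1` and `n + 2`. -/
theorem coeff_legendre_eq_centralBinom (n k : ℕ) :
    (legendre n).coeff k = (-1) ^ k * (k.centralBinom * (n + k).choose (2 * k)) := by
  rw [coeff_legendre, mul_assoc]
  congr 1
  rcases le_or_gt k n with h | h
  · have := Nat.choose_mul (n := n + k) (k := 2 * k) (s := k) (by omega)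
    rw [Nat.add_sub_cancel, show 2 * k - k = k by omega] at this
    rw [Nat.centralBinom, Nat.choose_symm_add]
    norm_cast
    rw [mul_comm _ ((n + k).choose (2 * k)), this, mul_comm]
  · rw [Nat.choose_eq_zero_of_lt h, Nat.choose_eq_zero_of_lt (show n + k < 2 * k by omega)]
    simp

theorem cast_choose_succ (n k : ℕ) :
    (n.choose (k + 1) : ℂ) * (k + 1) = n.choose k * (n - k) := by
  rcases le_or_gt k n with h | h
  · rw [← Nat.cast_sub h]
    exact_mod_cast Nat.choose_succ_right_eq n k
  · rw [Nat.choose_eq_zero_of_lt h, Nat.choose_eq_zero_of_lt (by omega)]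
    simp

/-- This is Legendre's differential equation read off coefficient by coefficient. -/
theorem coeff_legendre_succ (n k : ℕ) :
    (k + 1 : ℂ) ^ 2 * (legendre n).coeff (k + 1) =
      (k * (k + 1) - n * (n + 1)) * (legendre n).coeff k := by
  have h1 := cast_choose_succ n k
  have h2 : ((n + (k + 1)).choose n : ℂ) * (k + 1) = (n + k).choose n * (n + k + 1) := by
    have := Nat.choose_mul_succ_eq (n + k) n
    rw [show n + k + 1 - n = k + 1 by omega] at this
    exact_mod_cast this.symm
  rw [coeff_legendre, coeff_legendre, pow_succ]
  linear_combination (-1) ^ (k + 1) * ((n + (k + 1)).choose n : ℂ) * (k + 1) * h1 +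
    (-1) ^ (k + 1) * (n.choose k * (n - k) : ℂ) * h2

open Polynomial in
theorem legendre_ode (n : ℕ) :
    X * (1 - X) * derivative (derivative (legendre n)) + (1 - 2 * X) * derivative (legendre n) +
      C ((n : ℂ) * (n + 1)) * legendre n = 0 := by
  -- The divergence form `(X(1 - X) P')'` lets each coefficient be computed from two shifts.
  have h : X * (1 - X) * derivative (derivative (legendre n)) +
      (1 - 2 * X) * derivative (legendre n) =
      derivative (X * derivative (legendre n)) -
        derivative (X * (X * derivative (legendre n))) := by
    simp only [derivative_mul, derivative_X]; ring
  rw [h]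
  ext k
  simp only [coeff_add, coeff_sub, coeff_C_mul, coeff_derivative, coeff_X_mul, coeff_zero]
  rcases k with _ | k
  · have := coeff_legendre_succ n 0
    simp only [coeff_X_mul_zero]
    push_cast at this ⊢
    linear_combination this
  · have := coeff_legendre_succ n (k + 1)
    simp only [coeff_X_mul, coeff_derivative]
    push_cast at this ⊢
    linear_combination this

-- Bonnet's recurrence in the variable `1 - 2X`; it later determines the norms.
open Polynomial in
theorem legendre_recurrence (n : ℕ) :
    C (n + 2 : ℂ) * legendre (n + 2) =
      C (2 * n + 3 : ℂ) * ((1 - 2 * X) * legendre (n + 1)) - C (n + 1 : ℂ) * legendre n := by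
  have h : (1 - 2 * X) * legendre (n + 1) =
      legendre (n + 1) - C 2 * (X * legendre (n + 1)) := by
    rw [show (C 2 : ℂ[X]) = 2 from rfl]; ring
  rw [h]
  ext k
  simp only [coeff_sub, coeff_C_mul]
  rcases k with _ | k
  · simp only [coeff_X_mul_zero, coeff_legendre]
    simp; ring
  · simp only [coeff_X_mul, coeff_legendre_eq_centralBinom]
    -- Pascal's rule reduces all binomials to those of upper index `N`. The relations `hv` between
    -- neighbours and `hc` between central binomials then suffice.
    set N := n + k + 1 with hN
    have e0 : n + 1 + k = N := by omega
    have e1 : n + (k + 1) = N := by omega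
    have e2 : n + 1 + (k + 1) = N + 1 := by omega
    have e3 : n + 2 + (k + 1) = N + 1 + 1 := by omega
    have e4 : 2 * (k + 1) = 2 * k + 1 + 1 := by omega
    rw [e0, e1, e2, e3, e4]
    simp only [Nat.choose_succ_succ, Nat.succ_eq_add_one]
    have hv := cast_choose_succ N (2 * k)
    have hc : ((k + 1 : ℕ) : ℂ) * ((k + 1).centralBinom : ℂ) =
        2 * (2 * k + 1) * (k.centralBinom : ℂ) := by
      exact_mod_cast Nat.succ_mul_centralBinom_succ k
    have hk : ((k : ℂ) + 1) ≠ 0 := by exact_mod_cast Nat.succ_ne_zero k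
    apply mul_left_cancel₀ hk
    have hN' : (N : ℂ) = n + k + 1 := by rw [hN]; push_cast; ring
    rw [hN'] at hv
    push_cast at hv hc ⊢
    rw [pow_succ]
    generalize ((N.choose (2 * k + 1) : ℕ) : ℂ) = v at *
    generalize ((N.choose (2 * k) : ℕ) : ℂ) = u at *
    generalize ((N.choose (2 * k + 1 + 1) : ℕ) : ℂ) = t at *
    linear_combination (-1) ^ (k + 1) * (v + (n + 2) * u) * hc +
      2 * (-1) ^ (k + 1) * (k.centralBinom : ℂ) * hv

open Polynomial in
theorem coeff_C_add_C_mul_X_pow (a c : ℂ) (n k : ℕ) :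
    ((C a + C c * X) ^ n).coeff k = n.choose k * a ^ (n - k) * c ^ k := by
  have : (C a + C c * X) ^ n = ((X + C a) ^ n).comp (C c * X) := by
    simp [add_comm]
  rw [this, comp_C_mul_X_coeff, coeff_X_add_C_pow]
  ring

-- Rodrigues' formula: the polynomial is the `n`-th derivative of `X^n (1 - X)^n` over `n!`. Its
-- value at `w` is thus the `n`-th Taylor coefficient of `X^n (1 - X)^n` at `w`.
open Polynomial in
theorem legendre_eval (n : ℕ) (w : ℂ) :
    (legendre n).eval w = ((C w + C 1 * X) ^ n * (C (1 - w) + C (-1) * X) ^ n).coeff n := by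
  have h : (n.factorial : ℂ[X]) * legendre n = derivative^[n] (X ^ n * (1 - X) ^ n) := by
    have := congrArg (Polynomial.map (Int.castRingHom ℂ)) (factorial_mul_shiftedLegendre_eq n)
    rw [← iterate_derivative_map] at this
    simpa [legendre] using this
  have h2 : legendre n = hasseDeriv n (X ^ n * (1 - X) ^ n) := by
    have h3 := congrFun (factorial_smul_hasseDeriv (R := ℂ) n) (X ^ n * (1 - X) ^ n)
    rw [← h] at h3
    have h4 : (n.factorial : ℂ[X]) ≠ 0 := by exact_mod_cast n.factorial_ne_zero
    apply mul_left_cancel₀ h4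
    rw [← h3]
    simp
  rw [h2, ← taylor_coeff]
  congr 1
  simp [taylor_apply]
  ring

-- Take `w = -bc`, so that `1 - w = ad`. After exchanging the two indices, the binomial expansions
-- agree term by term, each term being a multiple of `(ad)^i (bc)^j`.
open Polynomial in
theorem coeff_mul_pow_eq_legendre_eval {a b c d : ℂ} (h : a * d - b * c = 1) (n : ℕ) :
    ((C a + C c * X) ^ n * (C b + C d * X) ^ n).coeff n = (legendre n).eval (-(b * c)) := by
  rw [legendre_eval, coeff_mul, coeff_mul, ← Finset.Nat.sum_antidiagonal_swap]
  refine Finset.sum_congr rfl fun p hp => ?_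
  replace hp := Finset.HasAntidiagonal.mem_antidiagonal.1 hp
  obtain ⟨i, j⟩ := p
  simp only at hp
  subst hp
  simp only [Prod.swap, coeff_C_add_C_mul_X_pow, Nat.add_sub_cancel, Nat.add_sub_cancel_left]
  rw [show (1 : ℂ) - -(b * c) = a * d by linear_combination -h, neg_pow (b * c) j]
  have : ((-1 : ℂ) ^ j) * (-1) ^ j = 1 := by rw [← mul_pow]; simp
  simp only [mul_pow, one_pow]
  linear_combination -(((i + j).choose i : ℂ) * (i + j).choose j * (a * d) ^ i * (b * c) ^ j) * this

/-! ### The zonal functions `t^ℓ₀₀` -/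

/-- The matrix entry `x ↦ x i j` as a smooth function. -/
def entryFun (i j : Fin 2) : Smooth := traceFun (Matrix.single j i 1)

@[simp] theorem entryFun_apply (i j : Fin 2) (x : SU2) :
    (entryFun i j : SU2 → ℂ) x = (x : Mat2) i j := by
  simp [entryFun, Matrix.trace_mul_single]

theorem lieDeriv_entryFun (Z : su2) (i j : Fin 2) :
    lieDeriv Z (entryFun i j) =
      (Z : Mat2) 0 j • entryFun i 0 + (Z : Mat2) 1 j • entryFun i 1 := by
  rw [entryFun, lieDeriv_traceFun]
  apply Subtype.ext; funext x
  change ((x : Mat2) * ((Z : Mat2) * Matrix.single j i 1)).trace =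
    (Z : Mat2) 0 j * (entryFun i 0 : SU2 → ℂ) x + (Z : Mat2) 1 j * (entryFun i 1 : SU2 → ℂ) x
  rw [← Matrix.mul_assoc, Matrix.trace_mul_single, entryFun_apply, entryFun_apply]
  simp [Matrix.mul_apply]
  ring

theorem entryFun_det :
    entryFun 0 0 * entryFun 1 1 - entryFun 0 1 * entryFun 1 0 = 1 := by
  apply Subtype.ext; funext x
  change (entryFun 0 0 : SU2 → ℂ) x * (entryFun 1 1 : SU2 → ℂ) x -
    (entryFun 0 1 : SU2 → ℂ) x * (entryFun 1 0 : SU2 → ℂ) x = 1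
  simp only [entryFun_apply]
  rw [← Matrix.det_fin_two]
  exact (Matrix.mem_specialUnitaryGroup_iff.1 x.2).2

/-- The function `|x₀₁|² = -x₀₁ x₁₀` on `SU(2)`. -/
def zonalCoord : Smooth := -(entryFun 0 1 * entryFun 1 0)

/-- The Laplacian in the directions transversal to the field `D₃`. -/
def transverseLaplacian : Smooth →ₗ[ℂ] Smooth :=
  lieDeriv Y1 ∘ₗ lieDeriv Y1 + lieDeriv Y2 ∘ₗ lieDeriv Y2

theorem lieDeriv_Y1_zonalCoord :
    lieDeriv Y1 zonalCoord = -(Complex.I / 2) •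
      (entryFun 0 0 * entryFun 1 0 + entryFun 0 1 * entryFun 1 1) := by
  simp only [zonalCoord, map_neg, lieDeriv_mul, lieDeriv_entryFun, Y1, Matrix.of_apply,
    Matrix.cons_val', Matrix.cons_val_zero, Matrix.cons_val_one, Matrix.cons_val_fin_one,
    zero_smul, add_zero, zero_add, smul_mul_assoc, mul_smul_comm]
  module

theorem lieDeriv_Y2_zonalCoord :
    lieDeriv Y2 zonalCoord = -(1 / 2 : ℂ) •
      (entryFun 0 0 * entryFun 1 0 - entryFun 0 1 * entryFun 1 1) := by
  simp only [zonalCoord, map_neg, lieDeriv_mul, lieDeriv_entryFun, Y2, Matrix.of_apply,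
    Matrix.cons_val', Matrix.cons_val_zero, Matrix.cons_val_one, Matrix.cons_val_fin_one,
    zero_smul, add_zero, zero_add, smul_mul_assoc, mul_smul_comm]
  module

/-- Right multiplication by the diagonal torus scales the two columns of `x` by inverse factors, so
`x₀₁ x₁₀` is unchanged. -/
theorem lieDeriv_Y3_zonalCoord : lieDeriv Y3 zonalCoord = 0 := by
  simp only [zonalCoord, map_neg, lieDeriv_mul, lieDeriv_entryFun, Y3, Matrix.of_apply,
    Matrix.cons_val', Matrix.cons_val_zero, Matrix.cons_val_one, Matrix.cons_val_fin_one,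
    zero_smul, add_zero, zero_add, smul_mul_assoc, mul_smul_comm]
  module

/-- Together with `lieDeriv_zonalCoord_sq` this says that on functions `p(w)` the transverse
Laplacian is Legendre's operator `w(1 - w) p'' + (1 - 2w) p'`. -/
theorem transverseLaplacian_zonalCoord :
    transverseLaplacian zonalCoord = 1 - 2 * zonalCoord := by
  have h : (1 : Smooth) - 2 * zonalCoord =
      entryFun 0 0 * entryFun 1 1 + entryFun 0 1 * entryFun 1 0 := by
    rw [← entryFun_det, zonalCoord]; ring
  rw [h, transverseLaplacian, LinearMap.add_apply, LinearMap.comp_apply, LinearMap.comp_apply,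
    lieDeriv_Y1_zonalCoord, lieDeriv_Y2_zonalCoord]
  simp only [map_smul, map_add, map_sub, lieDeriv_mul, lieDeriv_entryFun, Y1, Y2, Matrix.of_apply,
    Matrix.cons_val', Matrix.cons_val_zero, Matrix.cons_val_one, Matrix.cons_val_fin_one,
    zero_smul, add_zero, zero_add, smul_mul_assoc, mul_smul_comm]
  have hI := Complex.I_mul_I
  match_scalars <;> linear_combination -(1 / 2 : ℂ) * hI

theorem lieDeriv_zonalCoord_sq :
    lieDeriv Y1 zonalCoord ^ 2 + lieDeriv Y2 zonalCoord ^ 2 =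
      zonalCoord * (1 - zonalCoord) := by
  have h : (1 : Smooth) - zonalCoord = entryFun 0 0 * entryFun 1 1 := by
    rw [← entryFun_det, zonalCoord]; ring
  rw [h, lieDeriv_Y1_zonalCoord, lieDeriv_Y2_zonalCoord, smul_pow, smul_pow]
  have hI : (-(Complex.I / 2)) ^ 2 = -(1 / 4) := by
    linear_combination (1 / 4 : ℂ) * Complex.I_mul_I
  have h2 : (-(1 / 2 : ℂ)) ^ 2 = 1 / 4 := by norm_num
  rw [hI, h2, zonalCoord]
  have : (entryFun 0 0 * entryFun 1 0 - entryFun 0 1 * entryFun 1 1) ^ 2 =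
      (entryFun 0 0 * entryFun 1 0 + entryFun 0 1 * entryFun 1 1) ^ 2 +
      (4 : ℂ) • (-(entryFun 0 1 * entryFun 1 0) * (entryFun 0 0 * entryFun 1 1)) := by
    rw [show (4 : ℂ) • (-(entryFun 0 1 * entryFun 1 0) * (entryFun 0 0 * entryFun 1 1)) =
      4 * (-(entryFun 0 1 * entryFun 1 0) * (entryFun 0 0 * entryFun 1 1)) from by
        rw [Algebra.smul_def]; rfl]
    ring
  rw [this]
  module

/-- `∂_X` as a derivation of the algebra of smooth functions. -/
def lieDerivation (X : su2) : Derivation ℂ Smooth Smooth :=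
  Derivation.mk' (lieDeriv X) fun f g => by
    rw [lieDeriv_mul, smul_eq_mul, smul_eq_mul, add_comm, mul_comm g]

theorem lieDeriv_aeval (X : su2) (f : Smooth) (p : Polynomial ℂ) :
    lieDeriv X (Polynomial.aeval f p) =
      Polynomial.aeval f (Polynomial.derivative p) * lieDeriv X f :=
  (lieDerivation X).map_aeval p f

/-- The zonal function `t^n₀₀`, as a smooth function. -/
def zonal (n : ℕ) : Smooth := Polynomial.aeval zonalCoord (legendre n)

theorem zonal_apply_eq_eval (n : ℕ) (x : SU2) :
    (zonal n : SU2 → ℂ) x = (legendre n).eval (-((x : Mat2) 0 1 * (x : Mat2) 1 0)) := by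
  let ev : Smooth →ₐ[ℂ] ℂ := (Pi.evalAlgHom ℂ (fun _ : SU2 => ℂ) x).comp Smooth.val
  have h : ev (zonal n) = Polynomial.aeval (ev zonalCoord) (legendre n) :=
    (Polynomial.aeval_algHom_apply ev zonalCoord (legendre n)).symm
  have h2 : ev zonalCoord = -((x : Mat2) 0 1 * (x : Mat2) 1 0) := by
    change -((entryFun 0 1 : SU2 → ℂ) x * (entryFun 1 0 : SU2 → ℂ) x) = _
    rw [entryFun_apply, entryFun_apply]
  rw [h2, Polynomial.coe_aeval_eq_eval] at h
  exact h

/-- For the middle row and column the normalising square roots cancel, and the middle coefficient is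
a Legendre value by `coeff_mul_pow_eq_legendre_eval`. -/
theorem zonal_apply (n : ℕ) (x : SU2) : (zonal n : SU2 → ℂ) x = tZero n x := by
  have hdet : (x : Mat2).det = 1 := (Matrix.mem_specialUnitaryGroup_iff.1 x.2).2
  rw [Matrix.det_fin_two] at hdet
  rw [zonal_apply_eq_eval, ← coeff_mul_pow_eq_legendre_eval hdet, tZero, tMatrix]
  have h1 : √(((2 * n - n).factorial * n.factorial : ℕ) : ℝ) /
      √(((2 * n - n).factorial * n.factorial : ℕ) : ℝ) = 1 :=
    div_self (Real.sqrt_pos.2 (by positivity)).ne'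
  push_cast at h1
  simp only [h1, Complex.ofReal_one, one_mul]
  rw [show 2 * n - n = n by omega]

/-- The polynomial has integer coefficients and `-x₀₁ x₁₀` is real on `SU(2)`. Hence the bilinear
pairing of a zonal function with itself is its squared `L²` norm. -/
theorem conj_zonal (n : ℕ) (x : SU2) :
    (starRingEnd ℂ) ((zonal n : SU2 → ℂ) x) = (zonal n : SU2 → ℂ) x := by
  have hdet : (x : Mat2).det = 1 := (Matrix.mem_specialUnitaryGroup_iff.1 x.2).2
  have hstar : star (x : Mat2) = (x : Mat2).adjugate := by
    have h1 : star (x : Mat2) * (x : Mat2) = 1 :=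
      (Unitary.mem_iff.1 (Matrix.specialUnitaryGroup_le_unitaryGroup x.2)).1
    calc star (x : Mat2) = star (x : Mat2) * ((x : Mat2) * (x : Mat2).adjugate) := by
          rw [Matrix.mul_adjugate, hdet, one_smul, mul_one]
      _ = (x : Mat2).adjugate := by rw [← mul_assoc, h1, one_mul]
  rw [Matrix.adjugate_fin_two] at hstar
  have h01 : (starRingEnd ℂ) ((x : Mat2) 1 0) = -(x : Mat2) 0 1 := congrFun (congrFun hstar 0) 1
  have h10 : (starRingEnd ℂ) ((x : Mat2) 0 1) = -(x : Mat2) 1 0 := congrFun (congrFun hstar 1) 0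
  have hw : (starRingEnd ℂ) (-((x : Mat2) 0 1 * (x : Mat2) 1 0)) =
      -((x : Mat2) 0 1 * (x : Mat2) 1 0) := by
    rw [map_neg, map_mul, h01, h10]; ring
  rw [zonal_apply_eq_eval, ← Polynomial.eval_map_apply, hw]
  congr 1
  rw [legendre, Polynomial.map_map]
  congr 1
  exact RingHom.ext_int _ _

theorem aeval_two (f : Smooth) : Polynomial.aeval f (2 : Polynomial ℂ) = 2 := map_ofNat _ 2

theorem zonal_zero : zonal 0 = 1 := by
  have : legendre 0 = 1 := by
    simp [legendre, Polynomial.shiftedLegendre]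
  rw [zonal, this, map_one]

theorem zonal_one : zonal 1 = (1 - 2 * zonalCoord) * zonal 0 := by
  have : legendre 1 = 1 - 2 * Polynomial.X := by
    simp [legendre, Polynomial.shiftedLegendre, Finset.sum_range_succ]
    ring
  rw [zonal_zero, zonal, this]
  simp [aeval_two]

theorem zonal_recurrence (n : ℕ) :
    (n + 2 : ℂ) • zonal (n + 2) =
      (2 * n + 3 : ℂ) • ((1 - 2 * zonalCoord) * zonal (n + 1)) - (n + 1 : ℂ) • zonal n := by
  have h := congrArg (Polynomial.aeval zonalCoord) (legendre_recurrence n)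
  simp only [← Polynomial.smul_eq_C_mul] at h
  simp only [map_mul, map_sub, map_smul, map_one, Polynomial.aeval_X, aeval_two] at h
  exact h

theorem lieDeriv_Y3_zonal (n : ℕ) : lieDeriv Y3 (zonal n) = 0 := by
  rw [zonal, lieDeriv_aeval, lieDeriv_Y3_zonalCoord, mul_zero]

theorem transverseLaplacian_zonal (n : ℕ) :
    transverseLaplacian (zonal n) = -((n : ℂ) * (n + 1)) • zonal n := by
  have hode := congrArg (Polynomial.aeval zonalCoord) (legendre_ode n)
  rw [← Polynomial.smul_eq_C_mul] at hode
  simp only [map_mul, map_add, map_sub, map_smul, map_one, Polynomial.aeval_X, aeval_two,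
    map_zero] at hode
  rw [← lieDeriv_zonalCoord_sq, ← transverseLaplacian_zonalCoord] at hode
  simp only [transverseLaplacian, LinearMap.add_apply, LinearMap.comp_apply] at hode ⊢
  rw [neg_smul, ← sub_eq_zero, sub_neg_eq_add, ← hode, zonal]
  simp only [lieDeriv_aeval, lieDeriv_mul]
  ring

/-! ### Norms and Fourier coefficients of the zonal functions -/

theorem integralFunctional_apply (f φ : Smooth) :
    integralFunctional f φ = ∫ x, (f : SU2 → ℂ) x * (φ : SU2 → ℂ) x ∂haar := rfl

theorem integralFunctional_comm (f φ : Smooth) :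
    integralFunctional f φ = integralFunctional φ f := by
  simp only [integralFunctional_apply, mul_comm]

theorem integralFunctional_mul_left (f g φ : Smooth) :
    integralFunctional (f * g) φ = integralFunctional g (f * φ) := by
  simp only [integralFunctional_apply]
  refine integral_congr_ae (Filter.Eventually.of_forall fun x => ?_)
  change (f : SU2 → ℂ) x * (g : SU2 → ℂ) x * (φ : SU2 → ℂ) x =
    (g : SU2 → ℂ) x * ((f : SU2 → ℂ) x * (φ : SU2 → ℂ) x)
  ring

theorem integralFunctional_lieDeriv (X : su2) (f g : Smooth) :
    integralFunctional (lieDeriv X f) g = -integralFunctional f (lieDeriv X g) :=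
  integral_lieDeriv_mul X f g

theorem integralFunctional_transverseLaplacian (f g : Smooth) :
    integralFunctional (transverseLaplacian f) g =
      integralFunctional f (transverseLaplacian g) := by
  rw [integralFunctional_comm]
  simp only [transverseLaplacian, LinearMap.add_apply, LinearMap.comp_apply, map_add]
  rw [integralFunctional_comm g, integralFunctional_comm g]
  simp only [integralFunctional_lieDeriv, neg_neg]

theorem integralFunctional_zonal_transverseLaplacian (n : ℕ) (φ : Smooth) :
    integralFunctional (zonal n) (transverseLaplacian φ) =
      -((n : ℂ) * (n + 1)) * integralFunctional (zonal n) φ := by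
  rw [← integralFunctional_transverseLaplacian, transverseLaplacian_zonal,
    integralFunctional_comm, map_smul, smul_eq_mul, integralFunctional_comm]

/-- Eigenfunctions of a symmetric operator for distinct eigenvalues: `n(n + 1)` is injective on the
natural numbers. -/
theorem integralFunctional_zonal_zonal {m n : ℕ} (h : m ≠ n) :
    integralFunctional (zonal m) (zonal n) = 0 := by
  have h1 := integralFunctional_zonal_transverseLaplacian m (zonal n)
  rw [transverseLaplacian_zonal, map_smul, smul_eq_mul] at h1
  have h2 : ((m : ℂ) * (m + 1) - n * (n + 1)) * integralFunctional (zonal m) (zonal n) = 0 := by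
    linear_combination h1
  refine (mul_eq_zero.1 h2).resolve_left fun h3 => h ?_
  have h4 : ((m : ℂ) - n) * (m + n + 1) = 0 := by linear_combination h3
  rcases mul_eq_zero.1 h4 with h5 | h5
  · exact_mod_cast sub_eq_zero.1 h5
  · exact absurd (by exact_mod_cast h5) (Nat.succ_ne_zero (m + n))

theorem integralFunctional_zonal_recurrence (n : ℕ) (φ : Smooth) :
    (n + 2 : ℂ) * integralFunctional φ (zonal (n + 2)) =
      (2 * n + 3 : ℂ) * integralFunctional φ ((1 - 2 * zonalCoord) * zonal (n + 1)) -
        (n + 1 : ℂ) * integralFunctional φ (zonal n) := by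
  have h := congrArg (integralFunctional φ) (zonal_recurrence n)
  rw [map_smul, map_sub, map_smul, map_smul] at h
  exact h

/-- The squared norm of `t^n₀₀`. -/
theorem integralFunctional_zonal_self (n : ℕ) :
    (2 * n + 1 : ℂ) * integralFunctional (zonal n) (zonal n) = 1 := by
  -- Pair the recurrence with `zonal n`; the term with index `n + 2` vanishes by orthogonality.
  have hmid : ∀ n : ℕ, (2 * n + 3 : ℂ) *
      integralFunctional (zonal n) ((1 - 2 * zonalCoord) * zonal (n + 1)) =
        (n + 1) * integralFunctional (zonal n) (zonal n) := by
    intro n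
    have h := integralFunctional_zonal_recurrence n (zonal n)
    rw [integralFunctional_zonal_zonal (show n ≠ n + 2 by omega)] at h
    linear_combination -h
  have hswap : ∀ f g : Smooth, integralFunctional f ((1 - 2 * zonalCoord) * g) =
      integralFunctional g ((1 - 2 * zonalCoord) * f) := fun f g => by
    rw [integralFunctional_comm, integralFunctional_mul_left]
  have h0 : integralFunctional (zonal 0) (zonal 0) = 1 := by
    rw [zonal_zero, integralFunctional_apply]
    simp
  induction n with
  | zero => rw [h0]; simp
  | succ n ih =>
    rcases n with _ | n
    · have h1 := hmid 0
      rw [hswap, ← zonal_one, h0] at h1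
      push_cast at h1 ⊢
      linear_combination h1
    · have h1 := hmid (n + 1)
      -- Pairing the same recurrence with `zonal (n + 2)` produces the mixed integral of `hmid (n +
      -- 1)`. Eliminating it gives `(2n+5) ‖t^{n+2}₀₀‖² = (2n+3) ‖t^{n+1}₀₀‖²`.
      have h2 := integralFunctional_zonal_recurrence n (zonal (n + 2))
      rw [integralFunctional_zonal_zonal (show n + 2 ≠ n by omega), hswap] at h2
      have hn : (n + 2 : ℂ) ≠ 0 := by exact_mod_cast Nat.succ_ne_zero (n + 1)
      have hn3 : (2 * n + 3 : ℂ) ≠ 0 := by exact_mod_cast Nat.succ_ne_zero (2 * n + 2)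
      apply mul_left_cancel₀ hn
      push_cast at h1 ih ⊢
      linear_combination (2 * n + 5 : ℂ) * h2 + (2 * n + 3 : ℂ) * h1 + (n + 2 : ℂ) * ih

theorem integral_norm_zonal_le (n : ℕ) : ∫ x, ‖(zonal n : SU2 → ℂ) x‖ ∂haar ≤ 1 := by
  have hsq : ∫ x, ‖(zonal n : SU2 → ℂ) x‖ ^ 2 ∂haar ≤ 1 := by
    have h1 : integralFunctional (zonal n) (zonal n) =
        ((∫ x, ‖(zonal n : SU2 → ℂ) x‖ ^ 2 ∂haar : ℝ) : ℂ) := by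
      rw [← integral_complex_ofReal, integralFunctional_apply]
      refine integral_congr_ae (Filter.Eventually.of_forall fun x => ?_)
      change (zonal n : SU2 → ℂ) x * (zonal n : SU2 → ℂ) x =
        ((‖(zonal n : SU2 → ℂ) x‖ ^ 2 : ℝ) : ℂ)
      rw [← Complex.normSq_eq_norm_sq, ← Complex.mul_conj, conj_zonal]
    have h2 := integralFunctional_zonal_self n
    rw [h1] at h2
    have h3 : (2 * n + 1 : ℝ) * ∫ x, ‖(zonal n : SU2 → ℂ) x‖ ^ 2 ∂haar = 1 := by exact_mod_cast h2
    have h4 : 0 ≤ ∫ x, ‖(zonal n : SU2 → ℂ) x‖ ^ 2 ∂haar := integral_nonneg fun x => by positivity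
    nlinarith [mul_nonneg (Nat.cast_nonneg (α := ℝ) n) h4]
  have hc := (smooth_continuous (zonal n)).norm
  have hint : ∀ {g : SU2 → ℝ}, Continuous g → Integrable g haar := fun hg =>
    hg.integrable_of_hasCompactSupport (HasCompactSupport.of_compactSpace _)
  -- The inequality `s ≤ (1 + s²)/2` bounds the `L¹` norm by the `L²` norm on a probability space
  -- well enough.
  have h5 : ∫ x, ‖(zonal n : SU2 → ℂ) x‖ ∂haar ≤
      ∫ x, (1 / 2 + (1 / 2) * ‖(zonal n : SU2 → ℂ) x‖ ^ 2) ∂haar := by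
    refine integral_mono (hint hc) (hint (by fun_prop)) fun x => ?_
    change ‖(zonal n : SU2 → ℂ) x‖ ≤ 1 / 2 + 1 / 2 * ‖(zonal n : SU2 → ℂ) x‖ ^ 2
    nlinarith [sq_nonneg (‖(zonal n : SU2 → ℂ) x‖ - 1)]
  rw [integral_add (integrable_const _) (hint (by fun_prop)), integral_const_mul] at h5
  simp only [integral_const, probReal_univ, smul_eq_mul, one_mul] at h5
  linarith

theorem norm_integralFunctional_zonal_le (n : ℕ) (φ : Smooth) {M : ℝ}
    (hφ : ∀ x, ‖(φ : SU2 → ℂ) x‖ ≤ M) : ‖integralFunctional (zonal n) φ‖ ≤ M := by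
  have hM : 0 ≤ M := (norm_nonneg _).trans (hφ 1)
  calc ‖integralFunctional (zonal n) φ‖
      ≤ ∫ x, ‖(zonal n : SU2 → ℂ) x * (φ : SU2 → ℂ) x‖ ∂haar := norm_integral_le_integral_norm _
    _ ≤ ∫ x, ‖(zonal n : SU2 → ℂ) x‖ * M ∂haar := by
        refine integral_mono (integrable_mul _ _).norm
          ((smooth_integrable (zonal n)).norm.mul_const M) fun x => ?_
        simp only [norm_mul]
        exact mul_le_mul_of_nonneg_left (hφ x) (norm_nonneg _)
    _ = (∫ x, ‖(zonal n : SU2 → ℂ) x‖ ∂haar) * M := integral_mul_const _ _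
    _ ≤ 1 * M := mul_le_mul_of_nonneg_right (integral_norm_zonal_le n) hM
    _ = M := one_mul M

/-- The words of derivatives bounding the coefficients of the zonal series. -/
def zonalWords : List (List su2) :=
  [[], [Y1, Y1, Y1, Y1], [Y1, Y1, Y2, Y2], [Y2, Y2, Y1, Y1], [Y2, Y2, Y2, Y2]]

/-- Moving the transverse Laplacian onto `φ` twice gains `(n(n+1))²`. A single application would
gain only `n(n+1)`, which against the weight `2n + 1` is not summable. -/
theorem norm_zonal_coefficient_le (n : ℕ) (φ : Smooth) {M : ℝ}
    (h : ∀ w ∈ zonalWords, ∀ x, ‖(iterDeriv w φ : SU2 → ℂ) x‖ ≤ M) :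
    ‖(2 * (n : ℂ) + 1) * integralFunctional (zonal n) φ‖ ≤ 16 * (1 / ((n : ℝ) + 1) ^ 2) * M := by
  have h0 : ∀ x, ‖(φ : SU2 → ℂ) x‖ ≤ M := h [] (by simp [zonalWords])
  have hM : 0 ≤ M := (norm_nonneg _).trans (h0 1)
  have hcoef : ‖(2 * (n : ℂ) + 1)‖ = 2 * n + 1 := by
    rw [show (2 * (n : ℂ) + 1) = ((2 * n + 1 : ℕ) : ℂ) by push_cast; ring, Complex.norm_natCast]
    push_cast; ring
  rw [norm_mul, hcoef]
  rcases Nat.eq_zero_or_pos n with rfl | hn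
  · have := norm_integralFunctional_zonal_le 0 φ h0
    norm_num
    linarith
  · have hL : ∀ x, ‖(transverseLaplacian (transverseLaplacian φ) : SU2 → ℂ) x‖ ≤ 4 * M := by
      intro x
      have e : transverseLaplacian (transverseLaplacian φ) =
          iterDeriv [Y1, Y1, Y1, Y1] φ + iterDeriv [Y2, Y2, Y1, Y1] φ +
            iterDeriv [Y1, Y1, Y2, Y2] φ + iterDeriv [Y2, Y2, Y2, Y2] φ := by
        simp only [transverseLaplacian, LinearMap.add_apply, LinearMap.comp_apply, map_add,
          iterDeriv]
        abel
      rw [e]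
      have b1 := h [Y1, Y1, Y1, Y1] (by simp [zonalWords]) x
      have b2 := h [Y2, Y2, Y1, Y1] (by simp [zonalWords]) x
      have b3 := h [Y1, Y1, Y2, Y2] (by simp [zonalWords]) x
      have b4 := h [Y2, Y2, Y2, Y2] (by simp [zonalWords]) x
      refine (norm_add_le_of_le (norm_add_le_of_le (norm_add_le_of_le b1 b2) b3) b4).trans ?_
      linarith
    have h1 := norm_integralFunctional_zonal_le n _ hL
    rw [integralFunctional_zonal_transverseLaplacian,
      integralFunctional_zonal_transverseLaplacian, ← mul_assoc, norm_mul] at h1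
    have h2 : ‖-((n : ℂ) * (n + 1)) * -((n : ℂ) * (n + 1))‖ = ((n : ℝ) * (n + 1)) ^ 2 := by
      rw [show -((n : ℂ) * (n + 1)) * -((n : ℂ) * (n + 1)) = (((n * (n + 1)) ^ 2 : ℕ) : ℂ) by
        push_cast; ring, Complex.norm_natCast]
      push_cast; ring
    rw [h2] at h1
    set I := ‖integralFunctional (zonal n) φ‖
    have hn1 : (1 : ℝ) ≤ n := by exact_mod_cast hn
    have hI : 0 ≤ I := norm_nonneg _
    rw [mul_one_div, div_mul_eq_mul_div, le_div_iff₀ (by positivity)]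
    -- One factor `4` of the constant `16` comes from here, the other from the four words making up
    -- the squared Laplacian.
    have h3 : (2 * n + 1 : ℝ) ≤ 4 * n ^ 2 := by nlinarith
    calc (2 * n + 1 : ℝ) * I * (n + 1) ^ 2 = (2 * n + 1 : ℝ) * (I * (n + 1) ^ 2) := by ring
      _ ≤ 4 * n ^ 2 * (I * (n + 1) ^ 2) := mul_le_mul_of_nonneg_right h3 (by positivity)
      _ = 4 * (((n : ℝ) * (n + 1)) ^ 2 * I) := by ring
      _ ≤ 4 * (4 * M) := by linarith
      _ = 16 * M := by ring

/-! ### The zonal series -/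

/-- A series of functionals dominated termwise by a fixed finite set of seminorms, with summable
constants, converges to a distribution. -/
theorem exists_distribution_hasSum (T : ℕ → Smooth →ₗ[ℂ] ℂ) (S : Finset (List su2)) (b : ℕ → ℝ)
    (hb : Summable b)
    (hT : ∀ (n : ℕ) (φ : Smooth) (M : ℝ),
      (∀ w ∈ S, ∀ x, ‖(iterDeriv w φ : SU2 → ℂ) x‖ ≤ M) → ‖T n φ‖ ≤ b n * M) :
    ∃ f : Distribution, ∀ φ : Smooth, HasSum (fun n => T n φ) ((f : Smooth →ₗ[ℂ] ℂ) φ) := by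
  have hsum : ∀ φ : Smooth, Summable fun n => T n φ := by
    intro φ
    choose C hC hbound using fun w => smooth_bounded (iterDeriv w φ)
    refine Summable.of_norm_bounded (hb.mul_right (∑ w ∈ S, C w)) fun n => hT n φ _ ?_
    exact fun w hw x => (hbound w x).trans (Finset.single_le_sum (fun v _ => hC v) hw)
  let u : Smooth →ₗ[ℂ] ℂ :=
    { toFun := fun φ => ∑' n, T n φ
      map_add' := fun φ ψ => by simp only [map_add]; exact (hsum φ).tsum_add (hsum ψ)
      map_smul' := fun c φ => by simp only [map_smul, smul_eq_mul, RingHom.id_apply, tsum_mul_left] }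
  refine ⟨⟨u, S, ∑' n, b n, fun φ M h => ?_⟩, fun φ => (hsum φ).hasSum⟩
  exact tsum_of_norm_bounded (hb.hasSum.mul_right M) fun n => hT n φ M h

theorem exists_zonal_distribution :
    ∃ f : Distribution, ∀ φ : Smooth,
      HasSum (fun n : ℕ => (2 * (n : ℂ) + 1) * integralFunctional (zonal n) φ)
        ((f : Smooth →ₗ[ℂ] ℂ) φ) := by
  classical
  have hb : Summable fun n : ℕ => 16 * (1 / ((n : ℝ) + 1) ^ 2) := by
    refine Summable.mul_left 16 ?_
    have := (summable_nat_add_iff 1).2 (Real.summable_one_div_nat_pow.2 (le_refl 2))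
    simpa using this
  exact exists_distribution_hasSum
    (fun n => (2 * (n : ℂ) + 1) • integralFunctional (zonal n)) zonalWords.toFinset _ hb
    fun n φ M h => norm_zonal_coefficient_le n φ fun w hw => h w (List.mem_toFinset.2 hw)

/-- By orthogonality and the norm formula the series pairs to `1` with every `zonal m`. A smooth `g`
would then satisfy `m(m + 1) ≤ sup |(Y₁² + Y₂²) g|` for all `m`. -/
theorem not_isSmooth_of_zonal_hasSum {f : Distribution}
    (hf : ∀ φ : Smooth, HasSum (fun n : ℕ => (2 * (n : ℂ) + 1) * integralFunctional (zonal n) φ)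
      ((f : Smooth →ₗ[ℂ] ℂ) φ)) : ¬ IsSmooth f := by
  rintro ⟨g, rfl⟩
  have h1 : ∀ m : ℕ, integralFunctional (zonal m) g = 1 := by
    intro m
    have h := hasSum_single (f := fun n : ℕ =>
      (2 * (n : ℂ) + 1) * integralFunctional (zonal n) (zonal m)) m
      fun n hn => by rw [integralFunctional_zonal_zonal hn, mul_zero]
    rw [integralFunctional_zonal_self] at h
    rw [integralFunctional_comm]
    exact (hf (zonal m)).unique h
  obtain ⟨C, -, hC⟩ := smooth_bounded (transverseLaplacian g)
  obtain ⟨m, hm⟩ := exists_nat_gt C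
  have h2 := norm_integralFunctional_zonal_le m _ hC
  rw [integralFunctional_zonal_transverseLaplacian, h1, mul_one, norm_neg, norm_mul,
    Complex.norm_natCast, show ((m : ℂ) + 1) = ((m + 1 : ℕ) : ℂ) by push_cast; ring,
    Complex.norm_natCast] at h2
  push_cast at h2
  have hm0 : (0 : ℝ) ≤ m := Nat.cast_nonneg m
  nlinarith

/-- Each term is invariant under `D₃`, so integration by parts annihilates the series termwise. -/
theorem distDeriv_Y3_of_zonal_hasSum {f : Distribution}
    (hf : ∀ φ : Smooth, HasSum (fun n : ℕ => (2 * (n : ℂ) + 1) * integralFunctional (zonal n) φ)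
      ((f : Smooth →ₗ[ℂ] ℂ) φ)) : distDeriv Y3 f = 0 := by
  apply Subtype.ext; ext φ
  change -((f : Smooth →ₗ[ℂ] ℂ) (lieDeriv Y3 φ)) = 0
  have h := hf (lieDeriv Y3 φ)
  have h0 : ∀ n : ℕ, integralFunctional (zonal n) (lieDeriv Y3 φ) = 0 := fun n => by
    rw [← neg_eq_zero, ← integralFunctional_lieDeriv, lieDeriv_Y3_zonal, integralFunctional_comm,
      map_zero]
  simp only [h0, mul_zero] at h
  rw [h.unique hasSum_zero, neg_zero]

end GlobalHypo

end

open GlobalHypo in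
theorem mainTheorem9 :
    (∀ X : su2, (X : Mat2).det = 1 / 4 →
      (∀ c : ℂ, GloballyHypoelliptic (distDeriv X + c • LinearMap.id) ↔
        ¬ ∃ l : ℤ, Complex.I * c = (l : ℂ) / 2) ∧
      (∀ (k : ℕ) (c : ℂ), GloballyHypoelliptic (distDeriv X ^ k + c • LinearMap.id) ↔
        ¬ ∃ l : ℤ, c = -(-Complex.I) ^ k * ((l : ℂ) / 2) ^ k) ∧
      (∀ c : ℂ, GloballyHypoelliptic (distDeriv X ^ 2 + c • LinearMap.id) ↔
        ¬ ∃ l : ℤ, 4 * c = (l : ℂ) ^ 2)) ∧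
    (∀ (X : su2) (a : Smooth),
      ¬ GloballyHypoelliptic (distDeriv X ^ 2 + distMul a ∘ₗ distDeriv X)) ∧
    (∃ f : Distribution,
      (∀ φ : Smooth, HasSum
        (fun l : ℕ => (2 * (l : ℂ) + 1) * ∫ x, tZero l x * (φ : SU2 → ℂ) x ∂haar)
        ((f : Smooth →ₗ[ℂ] ℂ) φ)) ∧
      ¬ IsSmooth f ∧
      ∀ a : Smooth, (distDeriv Y3 ^ 2 + distMul a ∘ₗ distDeriv Y3) f = 0) := by
  refine ⟨fun X hX => ⟨globallyHypoelliptic_add_iff hX, globallyHypoelliptic_pow_add_iff hX,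
    globallyHypoelliptic_sq_add_iff hX⟩, not_globallyHypoelliptic_sq_add, ?_⟩
  obtain ⟨f, hf⟩ := exists_zonal_distribution
  refine ⟨f, fun φ => ?_, not_isSmooth_of_zonal_hasSum hf, fun a => ?_⟩
  · simpa only [integralFunctional_apply, zonal_apply] using hf φ
  · rw [LinearMap.add_apply, pow_two, Module.End.mul_apply, LinearMap.comp_apply,
      distDeriv_Y3_of_zonal_hasSum hf, map_zero, map_zero, add_zero]
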